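/- **Setting.** Let $G=(V,E)$ be a finite directed graph with $n=|V|\ge 1$ nodes and $m=|E|$ edges, and consider the triggering model on $G$: every node $v$ has a distribution of its random triggering set $\mathbb T(v)$, a set of in-neighbours of $v$, and the triggering sets of different nodes are independent. The random live-edge graph has the edges $(u,v)$ with $u\in\mathbb T(v)$. The influence spread $\sigma(S)$ is the expected number of nodes reachable from $S\subseteq V$ in the live-edge graph, and $\sigma^*_1=\max_{v\in V}\sigma(\{v\})$. The Shapley centrality of $v$ is the Shapley value $\psi_v=\frac1{n!}\sum_\pi\big(\sigma(S_{\pi,v}\cup\{v\})-\sigma(S_{\pi,v})\big)$, where $\pi$ runs over the orderings of $V$ and $S_{\pi,v}$ is the set of nodes preceding $v$ in $\pi$; the SNI (single node influence) centrality of $v$ is $\psi_v=\sigma(\{v\})$. A random reverse reachable (RR) set $R$ is generated by putting a uniformly random root into $R$ and then, as long as some node $u\in R$ has no triggering set yet, drawing $\mathbb T(u)$ and adding its elements to $R$. **Algorithm.** Given $\varepsilon>0$ and $\ell>0$, put $\varepsilon'=\sqrt2\,\varepsilon$. *Phase 1.* Let $LB=1$, $\theta_0=0$ and $est_v=0$ for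 all $v\in V$. For $i=1,\dots,\lfloor\log_2 n\rfloor-1$: let $x=n/2^i$ and $$\theta_i=\left\lceil \frac{n\big((\ell+1)\ln n+\ln\log_2 n+\ln 2\big)\big(2+\tfrac23\varepsilon'\big)}{\varepsilon'^2x}\right\rceil ;$$ generate $\theta_i-\theta_{i-1}$ new independent random RR sets, and for each of them, $R$, increase $est_u$ by $1$ for every $u\in R$; let $est^{(1)}=\max_v est_v$; if $n\cdot est^{(1)}/\theta_i\ge(1+\varepsilon')x$, set $LB=n\cdot est^{(1)}/(\theta_i(1+\varepsilon'))$ and leave the loop. *Phase 2.* Let $\theta=\left\lceil \frac{n((\ell+1)\ln n+\ln 4)(2+\frac23\varepsilon)}{\varepsilon^2\,LB}\right\rceil$ and reset $est_v=0$ for all $v$. Generate $\theta$ new independent random RR sets, and for each of them, $R$, increase $est_u$ for every $u\in R$ by $1/|R|$ in the Shapley version (a variant of ASV-RR) and by $1$ in the SNI version (a variant of ASNI-RR). Return $\hat\psi_v=n\cdot est_v/\theta$ for all $v\in V$. **Theorem.** In both versions, with $\psi$ the corresponding centrality: 1. For all $\varepsilon>0$ and $\ell>0$, with probability at least $1-n^{-\ell}$,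 $|\hat\psi_v-\psi_v|\le\varepsilon\,\sigma^*_1$ for all $v\in V$. 2. Assume that drawing $\mathbb T(v)$ takes time at most proportional to the in-degree of $v$, and that every elementary operation takes one unit of time. Then the expected running time is $O\big(\ell(m+n)\log n/\varepsilon^2\big)$, where $\varepsilon$ is bounded above and $\ell$ is bounded away from $0$. That is, for all $\kappa\in\mathbb N$, $\varepsilon_0>0$ and $\ell_0>0$ there is a constant $C$ such that the expected running time is at most $C\,\ell(m+n)\log n/\varepsilon^2$ for every such instance with $n\ge2$ in which drawing $\mathbb T(v)$ takes at most $\kappa\cdot\mathrm{indeg}(v)$ steps for every $v$, and all $0<\varepsilon\le\varepsilon_0$, $\ell\ge\ell_0$. -/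

import Mathlib

noncomputable section

/-! ### Randomized computations with a step count -/

/-- A randomized computation, given by the joint law of its result and of the number of steps it
takes. -/
structure Timed (α : Type) where
  law : PMF (α × ℕ)

namespace Timed

/-- Return `a` in zero steps. -/
def ret {α : Type} (a : α) : Timed α := ⟨PMF.pure (a, 0)⟩

/-- Sequential composition with fresh randomness; the step counts add up. -/
def seq {α β : Type} (x : Timed α) (f : α → Timed β) : Timed β :=
  ⟨x.law.bind fun a => (f a.1).law.map fun b => (b.1, a.2 + b.2)⟩

instance : Monad Timed where
  pure := ret
  bind := seq

/-- Spend `c` steps. -/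
def tick (c : ℕ) : Timed Unit := ⟨PMF.pure ((), c)⟩

/-- Draw a fresh sample from `p`, at the price of `c` steps. -/
def draw {α : Type} (p : PMF α) (c : ℕ) : Timed α := ⟨p.map fun a => (a, c)⟩

/-- The probability that the result satisfies `P`. -/
def prob {α : Type} (x : Timed α) (P : α → Prop) : ENNReal :=
  x.law.toOuterMeasure {o | P o.1}

/-- The expected number of steps. -/
def expectedTime {α : Type} (x : Timed α) : ENNReal :=
  ∑' o : α × ℕ, x.law o * (o.2 : ENNReal)

end Timed

/-! ### The triggering model -/

/-- An instance of the triggering model on the node set `V`: a directed graph and, for every node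
`v`, a distribution of the random triggering set of `v` over the sets of in-neighbours of `v`. -/
structure TriggeringModel (V : Type) where
  graph : Digraph V
  trig : V → PMF (Finset V)
  trig_subset : ∀ v, ∀ S ∈ (trig v).support, ∀ u ∈ S, graph.Adj u v

namespace TriggeringModel

variable {V : Type}

/-- The in-degree of `v`. -/
def inDeg (M : TriggeringModel V) (v : V) : ℕ := {u : V | M.graph.Adj u v}.ncard

/-- The number `m` of edges. -/
def numEdges (M : TriggeringModel V) : ℕ := {e : V × V | M.graph.Adj e.1 e.2}.ncard

end TriggeringModel

section Centralities

variable {V : Type} [Fintype V] [DecidableEq V]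

open scoped Classical in
/-- The nodes reachable from `S` in the live-edge graph with edges `(u, w)`, `u ∈ L w`. -/
def reach (L : V → Finset V) (S : Finset V) : Finset V :=
  Finset.univ.filter fun v => ∃ s ∈ S, Relation.ReflTransGen (fun u w => u ∈ L w) s v

/-- The influence spread `σ(S)`: the expected number of nodes reachable from `S` in the random
live-edge graph given by independent triggering sets `L v`, `v ∈ V`. -/
def TriggeringModel.spread (M : TriggeringModel V) (S : Finset V) : ℝ :=
  ∑ L : V → Finset V, (∏ v, (M.trig v (L v)).toReal) * ((reach L S).card : ℝ)

/-- The Shapley value of the player `v` in the game `τ`; an ordering of the players is a bijection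
`π` from `V` onto `{0, …, n - 1}`. -/
def shapleyValue (τ : Finset V → ℝ) (v : V) : ℝ :=
  (1 / (Nat.factorial (Fintype.card V) : ℝ)) *
    ∑ π : V ≃ Fin (Fintype.card V),
      (τ (insert v (Finset.univ.filter fun u => π u < π v)) -
        τ (Finset.univ.filter fun u => π u < π v))

/-- The two centrality measures: Shapley, and single node influence (SNI). -/
inductive Centrality
  | shapley
  | sni

/-- The centrality `ψ_v` of the node `v`. -/
def TriggeringModel.centrality (M : TriggeringModel V) : Centrality → V → ℝ
  | .shapley, v => shapleyValue M.spread v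
  | .sni, v => M.spread {v}

/-- The largest influence spread `σ*_1` of a single node. -/
def TriggeringModel.maxSpread [Nonempty V] (M : TriggeringModel V) : ℝ :=
  Finset.univ.sup' Finset.univ_nonempty fun v => M.spread {v}

end Centralities

/-! ### Random reverse reachable sets -/

section Algorithm

variable {V : Type} [Fintype V] [DecidableEq V]

/-- The main loop of the generation of an RR set. `Q` lists the nodes of `R` that do not have a
triggering set yet. As long as there is one, take the first, draw its triggering set (in `drawTime`
steps) and go through it, adding the new nodes to `R` and to `Q`. Every node enters `Q` at most
once, so the bound `Fintype.card V` on the number of rounds, used below, never cuts the loop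
short. -/
def rrLoop (M : TriggeringModel V) (drawTime : V → ℕ) :
    ℕ → List V → Finset V → Timed (Finset V)
  | 0, _, R => pure R
  | _ + 1, [], R => pure R
  | rounds + 1, u :: Q, R => do
      Timed.tick 1
      let T ← Timed.draw (M.trig u) (drawTime u)
      Timed.tick T.card
      rrLoop M drawTime rounds (Q ++ (T \ R).toList) (R ∪ T)

variable [Nonempty V]

/-- Generate a random RR set, from a uniformly random root. -/
def rrSet (M : TriggeringModel V) (drawTime : V → ℕ) : Timed (Finset V) := do
  let v ← Timed.draw (PMF.uniformOfFintype V) 1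
  rrLoop M drawTime (Fintype.card V) [v] {v}

/-- Generate `t` random RR sets; for each of them, say `R`, add `inc R` to the estimate of every
node of `R`. -/
def sampleLoop (M : TriggeringModel V) (drawTime : V → ℕ) (inc : Finset V → ℝ) :
    ℕ → (V → ℝ) → Timed (V → ℝ)
  | 0, est => pure est
  | t + 1, est => do
      let R ← rrSet M drawTime
      Timed.tick (1 + R.card)
      sampleLoop M drawTime inc t fun u => if u ∈ R then est u + inc R else est u

/-! ### The algorithm -/

/-- The number `θ_i` of RR sets generated by the end of iteration `i` of Phase 1, for `n` nodes;
here `ε' = √2 ε` and `x = n / 2 ^ i`, and `θ_0 = 0`. -/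
def theta1 (n : ℕ) (ε ℓ : ℝ) (i : ℕ) : ℕ :=
  if i = 0 then 0 else
    ⌈(n * ((ℓ + 1) * Real.log n + Real.log (Real.logb 2 n) + Real.log 2) *
        (2 + 2 / 3 * (√2 * ε))) / ((√2 * ε) ^ 2 * (n / 2 ^ i))⌉₊

/-- The number `θ` of RR sets generated in Phase 2. -/
def theta2 (n : ℕ) (ε ℓ LB : ℝ) : ℕ :=
  ⌈(n * ((ℓ + 1) * Real.log n + Real.log 4) * (2 + 2 / 3 * ε)) / (ε ^ 2 * LB)⌉₊

/-- The for-loop of Phase 1, from iteration `i` on with `r` iterations left. The increment is `1`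
and the largest estimate (`k = 1`) is tested. The result is the lower bound `LB`. -/
def phase1Loop (M : TriggeringModel V) (drawTime : V → ℕ) (ε ℓ : ℝ) :
    ℕ → ℕ → (V → ℝ) → Timed ℝ
  | 0, _, _ => pure 1
  | r + 1, i, est => do
      let n := Fintype.card V
      let est' ← sampleLoop M drawTime (fun _ => 1)
        (theta1 n ε ℓ i - theta1 n ε ℓ (i - 1)) est
      let top := Finset.univ.sup' Finset.univ_nonempty est'
      Timed.tick (1 + n)
      if n * top / theta1 n ε ℓ i ≥ (1 + √2 * ε) * (n / 2 ^ i) then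
        pure (n * top / (theta1 n ε ℓ i * (1 + √2 * ε)))
      else
        phase1Loop M drawTime ε ℓ r (i + 1) est'

/-- Phase 1: initialize the estimates and run (at most) `⌊log₂ n⌋ - 1` iterations. -/
def phase1 (M : TriggeringModel V) (drawTime : V → ℕ) (ε ℓ : ℝ) : Timed ℝ := do
  Timed.tick (1 + Fintype.card V)
  phase1Loop M drawTime ε ℓ (Nat.log 2 (Fintype.card V) - 1) 1 fun _ => 0

/-- The increment of Phase 2: `1 / |R|` for the Shapley centrality, `1` for the SNI centrality. -/
def Centrality.inc : Centrality → Finset V → ℝ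
  | .shapley, R => 1 / (R.card : ℝ)
  | .sni, _ => 1

/-- Phase 2: reset the estimates, generate `θ` fresh RR sets and rescale the estimates. -/
def phase2 (M : TriggeringModel V) (drawTime : V → ℕ) (c : Centrality) (ε ℓ LB : ℝ) :
    Timed (V → ℝ) := do
  let n := Fintype.card V
  let θ := theta2 n ε ℓ LB
  Timed.tick (1 + n)
  let est ← sampleLoop M drawTime c.inc θ fun _ => 0
  Timed.tick n
  pure fun v => n * est v / θ

/-- The variant of ASV-RR (`c = .shapley`) and of ASNI-RR (`c = .sni`) whose Phase 1 uses the
increment `1` and `k = 1`. -/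
def rrAlgorithm (M : TriggeringModel V) (drawTime : V → ℕ) (c : Centrality) (ε ℓ : ℝ) :
    Timed (V → ℝ) := do
  let LB ← phase1 M drawTime ε ℓ
  phase2 M drawTime c ε ℓ LB

end Algorithm

end

/-! Unbiasedness. By deferred decisions, a random RR set has the law of the set of nodes that reach
a uniform root in a fully drawn live-edge graph (`mean_rrLoop`, `mem_revReach`). So `σ(S)` is `n`
times the probability that `S` meets `R`. The Shapley value is linear, and in the game won by the
coalitions meeting `R` the members of `R` get `1/|R|` each (`shapleyValue_meets`). In both versions
an RR set thus adds to the estimate of `v` a fresh variable in `[0,1]` with mean `ψ_v/n ≤ σ*/n`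
(`rrMean_contrib`).

Accuracy. Chernoff bounds with deviation `δp`, where `p` only bounds the mean from above, have
exponent `tpδ²/(2 + 2δ/3)`; this dictates both sample sizes. A union bound over iterations and nodes
shows that Phase 1 returns `LB > σ*` with probability at most `n^(-ℓ)/2` (`prob_phase1_bad_le`). If
`0 < LB ≤ σ*`, then `θ` is large enough for Phase 2 to fail with probability at most `n^(-ℓ)/2`, by
a union bound over nodes and both tails (`prob_phase2_bad_le`).

Running time. Generating `R` costs `O(1 + indeg)` per member, and `u ∈ R` has probability `σ({u})/n
≤ σ*/n`, so the expected cost of an RR set is `O((m+n)σ*/n)` (`rrCost_le`). The expected number of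
RR sets is `O(1 + Qn/σ*)` with `Q` of order `ℓ log n/ε²` (`loopCost_phase1_le`): the first iteration
with `(1+ε')²x ≤ σ*` stops the loop except with probability `1/n`, and even the worst case needs
only `O(1 + nQ)` sets because `x ≥ 1` throughout. In the product the factors `σ*` of the main term
cancel. -/

set_option linter.unusedSectionVars false

/-! ### Calculus of expectations, probabilities and expected times -/

namespace Timed

variable {α β : Type}

/-- The expectation of a function of the result and of the number of steps. -/
noncomputable def expect (x : Timed α) (f : α × ℕ → ENNReal) : ENNReal := ∑' o, x.law o * f o

/-- The expectation of a function of the result. -/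
noncomputable def mean (x : Timed α) (f : α → ENNReal) : ENNReal := x.expect fun o => f o.1

theorem _root_.PMF.tsum_bind_mul {α β : Type} (p : PMF α) (q : α → PMF β) (f : β → ENNReal) :
    ∑' b, p.bind q b * f b = ∑' a, p a * ∑' b, q a b * f b := by
  simp only [PMF.bind_apply, ← ENNReal.tsum_mul_right, ← ENNReal.tsum_mul_left]
  rw [ENNReal.tsum_comm]
  simp only [mul_assoc]

theorem _root_.PMF.tsum_pure_mul {α : Type} (a : α) (f : α → ENNReal) :
    ∑' b, PMF.pure a b * f b = f a := by
  rw [tsum_eq_single a]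
  · simp
  · intro b hb
    simp [PMF.pure_apply, hb]

theorem _root_.PMF.tsum_map_mul {α β : Type} (p : PMF α) (g : α → β) (f : β → ENNReal) :
    ∑' b, p.map g b * f b = ∑' a, p a * f (g a) := by
  rw [PMF.map, PMF.tsum_bind_mul]
  simp only [Function.comp_apply, PMF.tsum_pure_mul]

theorem expect_pure (a : α) (f : α × ℕ → ENNReal) : (pure a : Timed α).expect f = f (a, 0) :=
  PMF.tsum_pure_mul _ _

theorem expect_bind (x : Timed α) (g : α → Timed β) (f : β × ℕ → ENNReal) :
    (x >>= g).expect f = x.expect fun o => (g o.1).expect fun p => f (p.1, o.2 + p.2) := by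
  change ∑' o, (x.law.bind fun a => (g a.1).law.map fun b => (b.1, a.2 + b.2)) o * f o = _
  rw [PMF.tsum_bind_mul]
  simp only [PMF.tsum_map_mul]
  rfl

theorem expect_tick (c : ℕ) (f : Unit × ℕ → ENNReal) : (tick c).expect f = f ((), c) :=
  PMF.tsum_pure_mul _ _

theorem expect_draw (p : PMF α) (c : ℕ) (f : α × ℕ → ENNReal) :
    (draw p c).expect f = ∑' a, p a * f (a, c) :=
  PMF.tsum_map_mul _ _ _

theorem expect_add (x : Timed α) (f g : α × ℕ → ENNReal) :
    x.expect (fun o => f o + g o) = x.expect f + x.expect g := by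
  simp only [expect, mul_add, ENNReal.tsum_add]

theorem expect_const (x : Timed α) (c : ENNReal) : x.expect (fun _ => c) = c := by
  simp only [expect, ENNReal.tsum_mul_right, x.law.tsum_coe, one_mul]

theorem expectedTime_eq_expect (x : Timed α) :
    x.expectedTime = x.expect fun o => (o.2 : ENNReal) := rfl

theorem mean_pure (a : α) (f : α → ENNReal) : (pure a : Timed α).mean f = f a :=
  expect_pure _ _

theorem mean_bind (x : Timed α) (g : α → Timed β) (f : β → ENNReal) :
    (x >>= g).mean f = x.mean fun a => (g a).mean f :=
  expect_bind _ _ _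

theorem mean_tick (c : ℕ) (f : Unit → ENNReal) : (tick c).mean f = f () :=
  expect_tick _ _

theorem mean_draw (p : PMF α) (c : ℕ) (f : α → ENNReal) :
    (draw p c).mean f = ∑' a, p a * f a :=
  expect_draw _ _ _

theorem mean_add (x : Timed α) (f g : α → ENNReal) :
    x.mean (fun a => f a + g a) = x.mean f + x.mean g :=
  expect_add _ _ _

theorem mean_const (x : Timed α) (c : ENNReal) : x.mean (fun _ => c) = c :=
  expect_const _ _

theorem mean_mul_left (x : Timed α) (c : ENNReal) (f : α → ENNReal) :
    x.mean (fun a => c * f a) = c * x.mean f := by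
  simp only [mean, expect, mul_left_comm _ c, ENNReal.tsum_mul_left]

theorem mean_mono (x : Timed α) {f g : α → ENNReal} (h : ∀ a, f a ≤ g a) :
    x.mean f ≤ x.mean g :=
  ENNReal.tsum_le_tsum fun o => mul_le_mul_right (h o.1) _

theorem mean_finset_sum {ι : Type} (x : Timed α) (s : Finset ι) (f : ι → α → ENNReal) :
    x.mean (fun a => ∑ i ∈ s, f i a) = ∑ i ∈ s, x.mean (f i) := by
  classical
  induction s using Finset.induction_on with
  | empty => simpa using x.mean_const 0
  | insert i s hi ih => simp only [Finset.sum_insert hi, mean_add, ih]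

theorem expectedTime_pure (a : α) : (pure a : Timed α).expectedTime = 0 := by
  simp [expectedTime_eq_expect, expect_pure]

theorem expectedTime_bind (x : Timed α) (g : α → Timed β) :
    (x >>= g).expectedTime = x.expectedTime + x.mean fun a => (g a).expectedTime := by
  simp only [expectedTime_eq_expect, expect_bind, Nat.cast_add, expect_add, expect_const, mean]

theorem expectedTime_tick (c : ℕ) : (tick c).expectedTime = c := by
  simp [expectedTime_eq_expect, expect_tick]

theorem expectedTime_draw (p : PMF α) (c : ℕ) : (draw p c).expectedTime = c := by
  simp [expectedTime_eq_expect, expect_draw, ENNReal.tsum_mul_right, p.tsum_coe]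

theorem prob_eq_mean (x : Timed α) (P : α → Prop) [DecidablePred P] :
    x.prob P = x.mean fun a => if P a then 1 else 0 := by
  rw [prob, PMF.toOuterMeasure_apply]
  refine tsum_congr fun o => ?_
  by_cases h : P o.1 <;> simp [Set.indicator, h]

theorem prob_bind (x : Timed α) (g : α → Timed β) (P : β → Prop) :
    (x >>= g).prob P = x.mean fun a => (g a).prob P := by
  classical
  simp only [prob_eq_mean, mean_bind]

theorem prob_mono (x : Timed α) {P Q : α → Prop} (h : ∀ a, P a → Q a) : x.prob P ≤ x.prob Q :=
  x.law.toOuterMeasure.mono fun o ho => h o.1 ho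

theorem prob_le_one (x : Timed α) (P : α → Prop) : x.prob P ≤ 1 := by
  classical
  rw [prob_eq_mean]
  refine (x.mean_mono (g := fun _ => 1) fun a => ?_).trans (x.mean_const 1).le
  split_ifs <;> simp

theorem prob_add_prob_not (x : Timed α) (P : α → Prop) :
    x.prob P + x.prob (fun a => ¬ P a) = 1 := by
  classical
  rw [prob_eq_mean, prob_eq_mean, ← mean_add]
  refine Eq.trans (congrArg x.mean (funext fun a => ?_)) (x.mean_const 1)
  by_cases h : P a <;> simp [h]

theorem prob_exists_le {ι : Type} [Fintype ι] (x : Timed α) (P : ι → α → Prop) :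
    x.prob (fun a => ∃ i, P i a) ≤ ∑ i, x.prob (P i) := by
  classical
  simp only [prob_eq_mean, ← mean_finset_sum]
  refine x.mean_mono fun a => ?_
  split_ifs with h
  · obtain ⟨i, hi⟩ := h
    refine le_trans (by simp [hi])
      (Finset.single_le_sum (f := fun i => if P i a then (1 : ENNReal) else 0)
        (fun _ _ => zero_le) (Finset.mem_univ i))
  · exact zero_le

theorem prob_or_le (x : Timed α) (P Q : α → Prop) :
    x.prob (fun a => P a ∨ Q a) ≤ x.prob P + x.prob Q := by
  classical
  simp only [prob_eq_mean, ← mean_add]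
  refine x.mean_mono fun a => ?_
  by_cases h : P a <;> by_cases h' : Q a <;> simp [h, h']

theorem prob_pure (a : α) (P : α → Prop) [Decidable (P a)] :
    (pure a : Timed α).prob P = if P a then 1 else 0 := by
  classical
  rw [prob_eq_mean, mean_pure]
  by_cases h : P a <;> simp [h]

/-- Markov's inequality for exponentials. -/
theorem prob_le_of_mean_exp (x : Timed α) (P : α → Prop) (h : α → ℝ) (b : ℝ)
    (hP : ∀ a, P a → b ≤ h a) :
    x.prob P ≤
      ENNReal.ofReal (Real.exp (-b)) * x.mean fun a => ENNReal.ofReal (Real.exp (h a)) := by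
  classical
  rw [prob_eq_mean, ← mean_mul_left]
  refine x.mean_mono fun a => ?_
  split_ifs with ha
  · rw [← ENNReal.ofReal_mul (Real.exp_pos _).le, ← Real.exp_add, ENNReal.one_le_ofReal,
      Real.one_le_exp_iff]
    linarith [hP a ha]
  · exact zero_le

end Timed

/-! ### The product law of the live-edge graph -/

namespace TriggeringModel

variable {V : Type} [Fintype V] [DecidableEq V]

/-- The weight of a live-edge graph. -/
noncomputable def liveProb (M : TriggeringModel V) (L : V → Finset V) : ENNReal :=
  ∏ v, M.trig v (L v)

theorem sum_liveProb (M : TriggeringModel V) : ∑ L : V → Finset V, M.liveProb L = 1 := by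
  simp only [liveProb]
  rw [← Fintype.prod_sum (fun v T => M.trig v T)]
  refine Finset.prod_eq_one fun v _ => ?_
  rw [← tsum_fintype (L := SummationFilter.unconditional _)]
  exact (M.trig v).tsum_coe

/-- Redrawing one triggering set does not change the law of the live-edge graph. -/
theorem sum_resample (M : TriggeringModel V) (u : V) (F : (V → Finset V) → ENNReal) :
    ∑ T, M.trig u T * ∑ L : V → Finset V, M.liveProb L * F (Function.update L u T) =
      ∑ L, M.liveProb L * F L := by
  classical
  -- Separate the coordinate `u` from the others: the weight factorizes, and the original value at
  -- `u` sums out to `1`.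
  let e := Equiv.funSplitAt u (Finset V)
  have hu : ∀ b L', e.symm (b, L') u = b := fun b L' => by simp [e, Equiv.funSplitAt]
  have hne : ∀ b L' (j : {j // j ≠ u}), e.symm (b, L') j = L' j := fun b L' j => by
    simp [e, Equiv.funSplitAt, j.2]
  have hP : ∀ b L', M.liveProb (e.symm (b, L')) =
      M.trig u b * ∏ j : {j // j ≠ u}, M.trig j (L' j) := by
    intro b L'
    rw [liveProb, Fintype.prod_eq_mul_prod_subtype_ne _ u, hu]
    simp only [hne]
  have hup : ∀ b L' T, Function.update (e.symm (b, L')) u T = e.symm (T, L') := by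
    intro b L' T
    funext j
    by_cases hj : j = u
    · subst hj
      rw [Function.update_self, hu]
    · rw [Function.update_of_ne hj, hne b L' ⟨j, hj⟩, hne T L' ⟨j, hj⟩]
  have hsum : ∀ G : (V → Finset V) → ENNReal,
      ∑ L, G L = ∑ b, ∑ L', G (e.symm (b, L')) := by
    intro G
    rw [← Fintype.sum_prod_type', ← e.symm.sum_comp]
  have h1 : ∑ b, M.trig u b = 1 := by
    rw [← tsum_fintype (L := SummationFilter.unconditional _)]
    exact (M.trig u).tsum_coe
  rw [hsum]
  refine Finset.sum_congr rfl fun T _ => ?_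
  rw [hsum]
  simp only [hP, hup, mul_assoc, ← Finset.mul_sum, ← Finset.sum_mul, h1, one_mul]

end TriggeringModel

/-! ### Reverse search in a fixed live-edge graph -/

section RevLoop

variable {V : Type} [DecidableEq V]

/-- The main loop of the generation of an RR set in a given live-edge graph. -/
noncomputable def revLoop (L : V → Finset V) : ℕ → List V → Finset V → Finset V
  | 0, _, R => R
  | _ + 1, [], R => R
  | k + 1, u :: Q, R => revLoop L k (Q ++ (L u \ R).toList) (R ∪ L u)

/-- A node that has left the queue stays in `R` and never re-enters, so its triggering set is not
consulted again. This is what allows the randomness to be drawn lazily. -/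
theorem revLoop_update (L : V → Finset V) {u : V} (T : Finset V) (k : ℕ) (Q : List V)
    (R : Finset V) (huQ : u ∉ Q) (huR : u ∈ R) :
    revLoop (Function.update L u T) k Q R = revLoop L k Q R := by
  induction k generalizing Q R with
  | zero => rfl
  | succ k ih =>
    cases Q with
    | nil => rfl
    | cons w Q =>
      rw [List.mem_cons, not_or] at huQ
      rw [revLoop, revLoop, Function.update_of_ne (Ne.symm huQ.1)]
      refine ih _ _ ?_ ?_
      · simp [huQ.2, huR]
      · simp [huR]

theorem nodup_append_sdiff {Q : List V} {R T : Finset V} (hQ : Q.Nodup) (hQR : ∀ w ∈ Q, w ∈ R) :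
    (Q ++ (T \ R).toList).Nodup := by
  refine hQ.append (Finset.nodup_toList _) fun w hw hw' => ?_
  rw [Finset.mem_toList, Finset.mem_sdiff] at hw'
  exact hw'.2 (hQR w hw)

theorem mem_of_mem_append_sdiff {Q : List V} {R T : Finset V} (hQR : ∀ w ∈ Q, w ∈ R) :
    ∀ w ∈ Q ++ (T \ R).toList, w ∈ R ∪ T := by
  intro w hw
  rw [List.mem_append, Finset.mem_toList, Finset.mem_sdiff] at hw
  rw [Finset.mem_union]
  exact hw.imp (hQR w) And.left

theorem subset_revLoop (L : V → Finset V) (k : ℕ) (Q : List V) (R : Finset V) :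
    R ⊆ revLoop L k Q R := by
  induction k generalizing Q R with
  | zero => exact subset_rfl
  | succ k ih =>
    cases Q with
    | nil => exact subset_rfl
    | cons w Q => exact Finset.subset_union_left.trans (ih _ _)

theorem revLoop_reaches (L : V → Finset V) (r : V) (k : ℕ) (Q : List V) (R : Finset V)
    (hQR : ∀ w ∈ Q, w ∈ R) (hR : ∀ w ∈ R, Relation.ReflTransGen (fun u w => u ∈ L w) w r) :
    ∀ w ∈ revLoop L k Q R, Relation.ReflTransGen (fun u w => u ∈ L w) w r := by
  induction k generalizing Q R with
  | zero => exact hR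
  | succ k ih =>
    cases Q with
    | nil => exact hR
    | cons u Q =>
      refine ih _ _ (mem_of_mem_append_sdiff fun w hw => hQR w (List.mem_cons_of_mem _ hw)) ?_
      intro w hw
      rcases Finset.mem_union.1 hw with hw | hw
      · exact hR w hw
      · exact Relation.ReflTransGen.head hw (hR u (hQR u List.mem_cons_self))

/-- Each round removes one node from the queue and moves new nodes from outside `R` into it, so the
left side of `hk` drops by exactly one. The queue is therefore empty before the rounds run out, and
processed nodes have all their in-neighbours in `R`. -/
theorem revLoop_closed [Fintype V] (L : V → Finset V) (k : ℕ) (Q : List V) (R : Finset V)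
    (hk : Q.length + (Finset.univ \ R).card ≤ k) (hR : ∀ w ∈ R, w ∉ Q → L w ⊆ R) :
    ∀ w ∈ revLoop L k Q R, L w ⊆ revLoop L k Q R := by
  induction k generalizing Q R with
  | zero =>
    have : Q = [] := List.eq_nil_of_length_eq_zero (by omega)
    subst this
    exact fun w hw => hR w hw (by simp)
  | succ k ih =>
    cases Q with
    | nil => exact fun w hw => hR w hw (by simp)
    | cons u Q =>
      refine ih _ _ ?_ ?_
      · have h1 : (Finset.univ \ R).card = (L u \ R).card + (Finset.univ \ (R ∪ L u)).card := by
          rw [← Finset.card_union_of_disjoint]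
          · congr 1
            ext w
            simp only [Finset.mem_sdiff, Finset.mem_univ, true_and, Finset.mem_union]
            tauto
          · rw [Finset.disjoint_left]
            simp only [Finset.mem_sdiff, Finset.mem_univ, true_and, Finset.mem_union]
            tauto
        simp only [List.length_cons, List.length_append, Finset.length_toList] at hk ⊢
        omega
      · intro w hw hwQ
        simp only [List.mem_append, Finset.mem_toList, Finset.mem_sdiff, not_or] at hwQ
        rw [Finset.mem_union] at hw
        have hwR : w ∈ R := by tauto
        by_cases hwu : w = u
        · subst hwu
          exact Finset.subset_union_right
        · exact (hR w hwR (by simp [hwu, hwQ.1])).trans Finset.subset_union_left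

/-- The nodes that reach `r` in the live-edge graph `L`. -/
noncomputable def revReach [Fintype V] (L : V → Finset V) (r : V) : Finset V :=
  revLoop L (Fintype.card V) [r] {r}

theorem mem_revReach [Fintype V] (L : V → Finset V) (r w : V) :
    w ∈ revReach L r ↔ Relation.ReflTransGen (fun u w => u ∈ L w) w r := by
  constructor
  · refine revLoop_reaches L r _ _ _ (by simp) ?_ w
    intro w hw
    rw [Finset.mem_singleton.1 hw]
  · intro h
    induction h using Relation.ReflTransGen.head_induction_on with
    | refl => exact subset_revLoop _ _ _ _ (Finset.mem_singleton_self r)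
    | head h _ ih =>
      refine revLoop_closed L _ _ _ ?_ (by simp) _ ih h
      rw [← Finset.compl_eq_univ_sdiff, Finset.card_compl, Finset.card_singleton]
      have := Fintype.card_pos_iff.2 ⟨r⟩
      simp
      omega

theorem card_reach [Fintype V] (L : V → Finset V) (S : Finset V) :
    (reach L S).card = ∑ r, if (S ∩ revReach L r).Nonempty then 1 else 0 := by
  rw [← Finset.card_filter]
  congr 1
  ext r
  simp only [reach, Finset.mem_filter, Finset.mem_univ, true_and]
  simp only [Finset.Nonempty, Finset.mem_inter, mem_revReach]

end RevLoop

/-! ### Law and cost of the RR loop -/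

section RRSet

variable {V : Type} [Fintype V] [DecidableEq V]

/-- Deferred decisions: drawing triggering sets on demand or all in advance gives the same law, as
each is used at most once. -/
theorem mean_rrLoop (M : TriggeringModel V) (d : V → ℕ) (g : Finset V → ENNReal) (k : ℕ)
    (Q : List V) (R : Finset V) (hQ : Q.Nodup) (hQR : ∀ w ∈ Q, w ∈ R) :
    (rrLoop M d k Q R).mean g = ∑ L, M.liveProb L * g (revLoop L k Q R) := by
  induction k generalizing Q R with
  | zero => simp [rrLoop, revLoop, Timed.mean_pure, ← Finset.sum_mul, M.sum_liveProb]
  | succ k ih =>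
    cases Q with
    | nil => simp [rrLoop, revLoop, Timed.mean_pure, ← Finset.sum_mul, M.sum_liveProb]
    | cons u Q =>
      have hQ' := List.nodup_cons.1 hQ
      have hQR' : ∀ w ∈ Q, w ∈ R := fun w hw => hQR w (List.mem_cons_of_mem _ hw)
      have hu : u ∈ R := hQR u List.mem_cons_self
      simp only [rrLoop, Timed.mean_bind, Timed.mean_tick, Timed.mean_draw]
      -- Overwrite the value of `L` at `u` by the fresh draw `T`; the rest of the search does not
      -- look at it.
      rw [tsum_fintype, ← M.sum_resample u]
      refine Finset.sum_congr rfl fun T _ => ?_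
      rw [ih _ _ (nodup_append_sdiff hQ'.2 hQR') (mem_of_mem_append_sdiff hQR')]
      congr 1
      refine Finset.sum_congr rfl fun L _ => ?_
      rw [revLoop, Function.update_self, revLoop_update]
      · simp [hQ'.1, hu]
      · simp [hu]

theorem TriggeringModel.card_le_inDeg (M : TriggeringModel V) (u : V) {T : Finset V}
    (hT : M.trig u T ≠ 0) : T.card ≤ M.inDeg u := by
  rw [inDeg, ← Set.ncard_coe_finset]
  exact Set.ncard_le_ncard (fun w hw => M.trig_subset u T ((PMF.mem_support_iff _ _).2 hT) w hw)
    (Set.toFinite _)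

/-- Amortization: the second summand on the left is the charge of the nodes already processed. Each
round moves one node into that set, and finally all processed nodes lie in `R'`. -/
theorem expectedTime_rrLoop_le (M : TriggeringModel V) (d : V → ℕ) (k : ℕ)
    (Q : List V) (R : Finset V) (hQ : Q.Nodup) (hQR : ∀ w ∈ Q, w ∈ R) :
    (rrLoop M d k Q R).expectedTime + ∑ u ∈ R \ Q.toFinset, ((1 + d u + M.inDeg u : ℕ) : ENNReal) ≤
      (rrLoop M d k Q R).mean fun R' => ∑ u ∈ R', ((1 + d u + M.inDeg u : ℕ) : ENNReal) := by
  induction k generalizing Q R with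
  | zero =>
    simp only [rrLoop, Timed.expectedTime_pure, Timed.mean_pure, zero_add]
    exact Finset.sum_le_sum_of_subset Finset.sdiff_subset
  | succ k ih =>
    cases Q with
    | nil =>
      simp only [rrLoop, Timed.expectedTime_pure, Timed.mean_pure, zero_add]
      exact Finset.sum_le_sum_of_subset Finset.sdiff_subset
    | cons u Q =>
      have hQ' := List.nodup_cons.1 hQ
      have hQR' : ∀ w ∈ Q, w ∈ R := fun w hw => hQR w (List.mem_cons_of_mem _ hw)
      have hu : u ∈ R := hQR u List.mem_cons_self
      simp only [rrLoop, Timed.expectedTime_bind, Timed.mean_bind, Timed.mean_tick,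
        Timed.mean_draw, Timed.expectedTime_tick, Timed.expectedTime_draw, tsum_fintype]
      have h1 : ∑ T, M.trig u T = 1 := by
        rw [← tsum_fintype (L := SummationFilter.unconditional _)]
        exact (M.trig u).tsum_coe
      have h2 : ∀ c : ENNReal, c = ∑ T, M.trig u T * c := fun c => by
        rw [← Finset.sum_mul, h1, one_mul]
      rw [h2 (∑ v ∈ R \ _, _), h2 ((1 : ℕ) : ENNReal), h2 (d u : ENNReal), ← Finset.sum_add_distrib,
        ← Finset.sum_add_distrib, ← Finset.sum_add_distrib]
      refine Finset.sum_le_sum fun T _ => ?_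
      simp only [← mul_add]
      -- Only sets in the support have size at most the in-degree.
      by_cases hT : M.trig u T = 0
      · simp [hT]
      refine mul_le_mul_right ?_ _
      refine le_trans ?_ (ih _ _ (nodup_append_sdiff hQ'.2 hQR') (mem_of_mem_append_sdiff hQR'))
      have hset : (R ∪ T) \ (Q ++ (T \ R).toList).toFinset = insert u (R \ (u :: Q).toFinset) := by
        ext w
        simp only [Finset.mem_sdiff, Finset.mem_union, List.mem_toFinset, List.mem_append,
          Finset.mem_toList, Finset.mem_insert, List.mem_cons]
        by_cases hw : w = u
        · subst hw
          simp [hu, hQ'.1]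
        · tauto
      rw [hset, Finset.sum_insert (by simp)]
      have hT' : (T.card : ENNReal) ≤ M.inDeg u := by
        exact_mod_cast M.card_le_inDeg u hT
      push_cast
      calc _ = (rrLoop M d k (Q ++ (T \ R).toList) (R ∪ T)).expectedTime +
            ((1 + d u + T.card : ENNReal) +
              ∑ v ∈ R \ (u :: Q).toFinset, (1 + d v + M.inDeg v : ENNReal)) := by ring
        _ ≤ _ := by gcongr

end RRSet

/-! ### Unbiasedness of the estimates -/

section Shapley

variable {V : Type} [Fintype V] [DecidableEq V]

/-- In the game won by the coalitions that meet `R`, the members of `R` share the value equally. -/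
theorem shapleyValue_meets (R : Finset V) (v : V) :
    shapleyValue (fun S => if (S ∩ R).Nonempty then (1 : ℝ) else 0) v =
      if v ∈ R then 1 / (R.card : ℝ) else 0 := by
  classical
  -- `F v π` indicates that no member of `R` precedes `v`; for `v ∈ R` this is exactly when `v` is
  -- pivotal.
  let F : V → (V ≃ Fin (Fintype.card V)) → ℝ := fun v π => if ∀ u ∈ R, π v ≤ π u then 1 else 0
  have hmarg : ∀ π : V ≃ Fin (Fintype.card V),
      ((if (insert v (Finset.univ.filter fun u => π u < π v) ∩ R).Nonempty then (1 : ℝ) else 0) -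
        if ((Finset.univ.filter fun u => π u < π v) ∩ R).Nonempty then 1 else 0) =
      if v ∈ R then F v π else 0 := by
    intro π
    have hb : ((Finset.univ.filter fun u => π u < π v) ∩ R).Nonempty ↔ ¬ ∀ u ∈ R, π v ≤ π u := by
      simp only [Finset.Nonempty, Finset.mem_inter, Finset.mem_filter, Finset.mem_univ, true_and]
      push Not
      exact exists_congr fun _ => and_comm
    by_cases hv : v ∈ R
    · rw [if_pos ⟨v, by simp [hv]⟩, if_pos hv]
      by_cases h : ∀ u ∈ R, π v ≤ π u
      · rw [if_neg (fun h' => hb.1 h' h)]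
        simp [F, if_pos h]
      · rw [if_pos (hb.2 h)]
        simp [F, if_neg h]
    · rw [Finset.insert_inter_of_notMem hv, if_neg hv, sub_self]
  simp only [shapleyValue, hmarg]
  split_ifs with hv
  -- Swapping `v` and `w` permutes the orderings and preserves `R`, so all members are first equally
  -- often; exactly one is first in each ordering.
  · have hsymm : ∀ w ∈ R, ∑ π, F w π = ∑ π, F v π := by
      intro w hw
      rw [← (Equiv.equivCongr (Equiv.swap v w) (Equiv.refl _)).sum_comp]
      refine Finset.sum_congr rfl fun π _ => ?_
      have : (∀ u ∈ R, π (Equiv.swap v w w) ≤ π (Equiv.swap v w u)) ↔ ∀ u ∈ R, π v ≤ π u := by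
        rw [Equiv.swap_apply_right]
        have hmem : ∀ u ∈ R, Equiv.swap v w u ∈ R := by
          intro u hu
          rw [Equiv.swap_apply_def]
          split_ifs <;> assumption
        refine ⟨fun h u hu => ?_, fun h u hu => h _ (hmem u hu)⟩
        have := h _ (hmem u hu)
        rwa [Equiv.swap_apply_self] at this
      simpa [F, Equiv.equivCongr] using if_congr this rfl rfl
    have hone : ∀ π, ∑ w ∈ R, F w π = 1 := by
      intro π
      obtain ⟨w, hw, hmin⟩ := R.exists_min_image π ⟨v, hv⟩
      rw [Finset.sum_eq_single_of_mem w hw]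
      · simp only [F, if_pos hmin]
      · intro w' hw' hne
        simp only [F]
        refine if_neg fun h => hne (π.injective (le_antisymm (h w hw) (hmin w' hw')))
    have htot : (R.card : ℝ) * ∑ π, F v π = (Fintype.card V).factorial := by
      rw [← nsmul_eq_mul, ← Finset.sum_const, ← Finset.sum_congr rfl hsymm, Finset.sum_comm]
      simp only [hone, Finset.sum_const, Finset.card_univ, nsmul_eq_mul, mul_one]
      rw [Fintype.card_equiv (Fintype.equivFin V)]
    have hR : (R.card : ℝ) ≠ 0 := by
      exact_mod_cast (Finset.card_pos.2 ⟨v, hv⟩).ne'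
    have hf : ((Fintype.card V).factorial : ℝ) ≠ 0 := by exact_mod_cast Nat.factorial_ne_zero _
    field_simp
    linarith
  · simp

/-- The average of `g` over the random RR set. -/
noncomputable def TriggeringModel.rrMean (M : TriggeringModel V) (g : Finset V → ℝ) : ℝ :=
  ∑ r, (1 / (Fintype.card V : ℝ)) * ∑ L, (M.liveProb L).toReal * g (revReach L r)

/-- The contribution of the RR set `R` to the estimate of `v`. -/
noncomputable def Centrality.contrib (c : Centrality) (v : V) (R : Finset V) : ℝ :=
  if v ∈ R then c.inc R else 0

theorem TriggeringModel.spread_eq_sum_revReach (M : TriggeringModel V) (S : Finset V) :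
    M.spread S = ∑ L, (M.liveProb L).toReal *
      ∑ r, if (S ∩ revReach L r).Nonempty then (1 : ℝ) else 0 := by
  simp only [spread, liveProb, ENNReal.toReal_prod, card_reach]
  push_cast
  rfl

/-- The spread is a mixture of the games won by meeting a reverse reachable set, and the Shapley
value is linear in the game. -/
theorem TriggeringModel.centrality_eq_sum_revReach (M : TriggeringModel V) (c : Centrality)
    (v : V) :
    M.centrality c v = ∑ L, (M.liveProb L).toReal * ∑ r, c.contrib v (revReach L r) := by
  cases c with
  | sni =>
    have h : ∀ R : Finset V, ({v} ∩ R).Nonempty ↔ v ∈ R := fun R => by simp [Finset.Nonempty]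
    simp only [centrality, M.spread_eq_sum_revReach, Centrality.contrib, Centrality.inc, h]
  | shapley =>
    simp only [centrality, Centrality.contrib, Centrality.inc, ← shapleyValue_meets]
    simp only [shapleyValue, M.spread_eq_sum_revReach]
    simp only [Finset.mul_sum, ← Finset.sum_sub_distrib]
    rw [Finset.sum_comm]
    refine Finset.sum_congr rfl fun L _ => ?_
    rw [Finset.sum_comm]
    refine Finset.sum_congr rfl fun r _ => Finset.sum_congr rfl fun π _ => ?_
    ring

theorem TriggeringModel.rrMean_contrib (M : TriggeringModel V) (c : Centrality) (v : V) :
    M.rrMean (c.contrib v) = M.centrality c v / Fintype.card V := by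
  rw [M.centrality_eq_sum_revReach, rrMean, ← Finset.mul_sum, Finset.sum_comm]
  simp only [← Finset.mul_sum]
  ring

theorem TriggeringModel.rrMean_mono (M : TriggeringModel V) {f g : Finset V → ℝ}
    (h : ∀ R, f R ≤ g R) : M.rrMean f ≤ M.rrMean g := by
  refine Finset.sum_le_sum fun r _ => mul_le_mul_of_nonneg_left ?_ (by positivity)
  exact Finset.sum_le_sum fun L _ => mul_le_mul_of_nonneg_left (h _) ENNReal.toReal_nonneg

theorem TriggeringModel.liveProb_ne_top (M : TriggeringModel V) (L : V → Finset V) :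
    M.liveProb L ≠ ⊤ :=
  ENNReal.prod_ne_top fun v _ => (M.trig v).apply_ne_top _

theorem TriggeringModel.sum_toReal_liveProb (M : TriggeringModel V) :
    ∑ L, (M.liveProb L).toReal = 1 := by
  rw [← ENNReal.toReal_sum fun L _ => M.liveProb_ne_top L, M.sum_liveProb, ENNReal.toReal_one]

theorem TriggeringModel.rrMean_affine [Nonempty V] (M : TriggeringModel V) (a b : ℝ)
    (g : Finset V → ℝ) : M.rrMean (fun R => a + b * g R) = a + b * M.rrMean g := by
  have hn : (Fintype.card V : ℝ) ≠ 0 := by exact_mod_cast Fintype.card_ne_zero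
  simp only [rrMean, mul_add, Finset.sum_add_distrib, ← Finset.sum_mul, M.sum_toReal_liveProb,
    Finset.sum_const, Finset.card_univ, nsmul_eq_mul, one_mul, mul_left_comm _ b,
    ← Finset.mul_sum]
  field_simp

end Shapley

/-! ### Moments and expected cost of a random RR set -/

section RRSet

variable {V : Type} [Fintype V] [DecidableEq V] [Nonempty V]

theorem mean_rrSet (M : TriggeringModel V) (d : V → ℕ) (g : Finset V → ENNReal) :
    (rrSet M d).mean g =
      ∑ r, (Fintype.card V : ENNReal)⁻¹ * ∑ L, M.liveProb L * g (revReach L r) := by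
  simp only [rrSet, Timed.mean_bind, Timed.mean_draw, tsum_fintype, PMF.uniformOfFintype_apply]
  refine Finset.sum_congr rfl fun r _ => ?_
  rw [mean_rrLoop _ _ _ _ _ _ (by simp) (by simp)]
  rfl

theorem mean_rrSet_ofReal (M : TriggeringModel V) (d : V → ℕ) (g : Finset V → ℝ)
    (hg : ∀ R, 0 ≤ g R) :
    ((rrSet M d).mean fun R => ENNReal.ofReal (g R)) = ENNReal.ofReal (M.rrMean g) := by
  have h1 : ∀ r L, 0 ≤ (M.liveProb L).toReal * g (revReach L r) := fun r L =>
    mul_nonneg ENNReal.toReal_nonneg (hg _)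
  rw [mean_rrSet, TriggeringModel.rrMean, ENNReal.ofReal_sum_of_nonneg fun r _ =>
    mul_nonneg (by positivity) (Finset.sum_nonneg fun L _ => h1 r L)]
  refine Finset.sum_congr rfl fun r _ => ?_
  rw [ENNReal.ofReal_mul (by positivity), ENNReal.ofReal_sum_of_nonneg fun L _ => h1 r L, one_div,
    ENNReal.ofReal_inv_of_pos (by exact_mod_cast Fintype.card_pos), ENNReal.ofReal_natCast]
  congr 1
  refine Finset.sum_congr rfl fun L _ => ?_
  rw [ENNReal.ofReal_mul ENNReal.toReal_nonneg, ENNReal.ofReal_toReal (M.liveProb_ne_top L)]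

theorem TriggeringModel.one_le_spread (M : TriggeringModel V) (v : V) : 1 ≤ M.spread {v} := by
  rw [M.spread_eq_sum_revReach]
  refine M.sum_toReal_liveProb.ge.trans (Finset.sum_le_sum fun L _ => ?_)
  refine le_mul_of_one_le_right ENNReal.toReal_nonneg ?_
  refine le_trans ?_ (Finset.single_le_sum (fun r _ => ?_) (Finset.mem_univ v))
  · rw [if_pos ⟨v, by simp [mem_revReach, Relation.ReflTransGen.refl]⟩]
  · positivity

theorem TriggeringModel.spread_le_card (M : TriggeringModel V) (v : V) :
    M.spread {v} ≤ Fintype.card V := by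
  have h : ∑ L, (M.liveProb L).toReal * Fintype.card V = Fintype.card V := by
    rw [← Finset.sum_mul, M.sum_toReal_liveProb, one_mul]
  rw [M.spread_eq_sum_revReach, ← h]
  refine Finset.sum_le_sum fun L _ => mul_le_mul_of_nonneg_left ?_ ENNReal.toReal_nonneg
  refine (Finset.sum_le_card_nsmul _ _ 1 fun r _ => ?_).trans (by simp)
  split_ifs <;> norm_num

theorem TriggeringModel.spread_le_maxSpread (M : TriggeringModel V) (v : V) :
    M.spread {v} ≤ M.maxSpread :=
  Finset.le_sup' (fun v => M.spread {v}) (Finset.mem_univ v)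

theorem TriggeringModel.exists_spread_eq_maxSpread (M : TriggeringModel V) :
    ∃ v, M.spread {v} = M.maxSpread := by
  obtain ⟨v, -, hv⟩ := Finset.exists_mem_eq_sup' Finset.univ_nonempty fun v => M.spread {v}
  exact ⟨v, hv.symm⟩

theorem TriggeringModel.one_le_maxSpread (M : TriggeringModel V) : 1 ≤ M.maxSpread := by
  obtain ⟨v, hv⟩ := M.exists_spread_eq_maxSpread
  exact hv ▸ M.one_le_spread v

theorem TriggeringModel.maxSpread_le_card (M : TriggeringModel V) :
    M.maxSpread ≤ Fintype.card V := by
  obtain ⟨v, hv⟩ := M.exists_spread_eq_maxSpread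
  exact hv ▸ M.spread_le_card v

theorem Centrality.contrib_nonneg (c : Centrality) (v : V) (R : Finset V) :
    0 ≤ c.contrib v R := by
  unfold contrib
  split_ifs
  · cases c <;> simp [inc]
  · rfl

theorem Centrality.contrib_le_sni (c : Centrality) (v : V) (R : Finset V) :
    c.contrib v R ≤ Centrality.sni.contrib v R := by
  unfold contrib
  split_ifs with h
  · cases c with
    | sni => rfl
    | shapley =>
      have : (1 : ℝ) ≤ R.card := by exact_mod_cast Finset.card_pos.2 ⟨v, h⟩
      exact div_le_one_of_le₀ this (by positivity)
  · rfl

theorem Centrality.contrib_le_one (c : Centrality) (v : V) (R : Finset V) :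
    c.contrib v R ≤ 1 := by
  refine (c.contrib_le_sni v R).trans ?_
  unfold contrib
  split_ifs <;> simp [inc]

theorem TriggeringModel.rrMean_contrib_le (M : TriggeringModel V) (c : Centrality) (v : V) :
    M.rrMean (c.contrib v) ≤ M.maxSpread / Fintype.card V := by
  refine (M.rrMean_mono (c.contrib_le_sni v)).trans ?_
  rw [M.rrMean_contrib]
  gcongr
  exact M.spread_le_maxSpread v

/-- By linearity the left side is the sum of `w u` times the probability of `u ∈ R`, which is
`σ({u})/n`. -/
theorem mean_rrSet_sum (M : TriggeringModel V) (d : V → ℕ) (w : V → ℕ) :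
    ((rrSet M d).mean fun R => ∑ u ∈ R, (w u : ENNReal)) ≤
      ENNReal.ofReal (M.maxSpread / Fintype.card V * ∑ u, (w u : ℝ)) := by
  have h : ∀ R : Finset V, ∑ u ∈ R, (w u : ENNReal) =
      ∑ u, (w u : ENNReal) * ENNReal.ofReal (Centrality.sni.contrib u R) := by
    intro R
    rw [← Finset.sum_filter_add_sum_filter_not Finset.univ (· ∈ R), Finset.filter_univ_mem,
      Finset.sum_congr rfl fun u hu => ?_, Finset.sum_eq_zero (s := Finset.univ.filter (· ∉ R)),
      add_zero]
    · intro u hu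
      simp [Centrality.contrib, (Finset.mem_filter.1 hu).2]
    · simp [Centrality.contrib, hu, Centrality.inc]
  simp only [h, Timed.mean_finset_sum, Timed.mean_mul_left,
    mean_rrSet_ofReal M d _ (Centrality.sni.contrib_nonneg _)]
  rw [Finset.mul_sum, ENNReal.ofReal_sum_of_nonneg]
  · refine Finset.sum_le_sum fun u _ => ?_
    rw [mul_comm, ENNReal.ofReal_mul, ENNReal.ofReal_natCast]
    · gcongr
      exact M.rrMean_contrib_le _ u
    · have := M.one_le_maxSpread
      positivity
  · intro u _
    have := M.one_le_maxSpread
    positivity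

theorem expectedTime_rrSet_le (M : TriggeringModel V) (d : V → ℕ) :
    (rrSet M d).expectedTime ≤
      1 + (rrSet M d).mean fun R => ∑ u ∈ R, ((1 + d u + M.inDeg u : ℕ) : ENNReal) := by
  simp only [rrSet, Timed.expectedTime_bind, Timed.expectedTime_draw, Timed.mean_bind]
  refine add_le_add (by simp) (Timed.mean_mono _ fun r => ?_)
  exact le_self_add.trans (expectedTime_rrLoop_le M d _ [r] {r} (by simp) (by simp))

theorem TriggeringModel.sum_inDeg (M : TriggeringModel V) : ∑ v, M.inDeg v = M.numEdges := by
  classical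
  simp only [inDeg, numEdges, Set.ncard_eq_toFinset_card', Set.toFinset_ofPred]
  rw [← Finset.card_sigma]
  refine Finset.card_bij (fun a _ => (a.2, a.1)) ?_ ?_ ?_
  · rintro ⟨a, b⟩
    simp
  · rintro ⟨a, b⟩ _ ⟨a', b'⟩ _ h
    simp only [Prod.mk.injEq] at h
    simp [h.1, h.2]
  · rintro ⟨a, b⟩ h
    exact ⟨⟨b, a⟩, by simpa using h, rfl⟩

/-- The expected time of generating an RR set and updating the estimates. -/
noncomputable def rrCost (M : TriggeringModel V) (d : V → ℕ) : ENNReal :=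
  (rrSet M d).expectedTime + (rrSet M d).mean fun R => ((1 + R.card : ℕ) : ENNReal)

/-- The weights sum to at most `n + (κ+1)m`, updating the estimates adds `n`, and the two unit costs
fit into `2n` since `σ*/n · n ≥ 1`. -/
theorem rrCost_le (M : TriggeringModel V) (d : V → ℕ) (κ : ℕ)
    (hd : ∀ v, d v ≤ κ * M.inDeg v) :
    rrCost M d ≤
      ENNReal.ofReal ((κ + 4) * (M.maxSpread / Fintype.card V) *
        (M.numEdges + Fintype.card V)) := by
  have hσ := M.one_le_maxSpread
  have hn : (0 : ℝ) < Fintype.card V := by exact_mod_cast Fintype.card_pos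
  calc _ ≤ (1 + (rrSet M d).mean fun R => ∑ u ∈ R, ((1 + d u + M.inDeg u : ℕ) : ENNReal)) +
        (1 + (rrSet M d).mean fun R => ∑ u ∈ R, ((1 : ℕ) : ENNReal)) := by
        refine add_le_add (expectedTime_rrSet_le M d) (le_of_eq ?_)
        rw [← Timed.mean_const (rrSet M d) 1, ← Timed.mean_add]
        simp
    _ ≤ (1 + ENNReal.ofReal (M.maxSpread / Fintype.card V * ∑ u, ((1 + d u + M.inDeg u : ℕ) : ℝ))) +
        (1 + ENNReal.ofReal (M.maxSpread / Fintype.card V * ∑ u : V, ((1 : ℕ) : ℝ))) := by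
        gcongr <;> exact mean_rrSet_sum M d _
    _ = ENNReal.ofReal (1 + M.maxSpread / Fintype.card V * ∑ u, ((1 + d u + M.inDeg u : ℕ) : ℝ) +
        (1 + M.maxSpread / Fintype.card V * ∑ u : V, ((1 : ℕ) : ℝ))) := by
        rw [ENNReal.ofReal_add (by positivity) (by positivity),
          ENNReal.ofReal_add (by positivity) (by positivity),
          ENNReal.ofReal_add (by positivity) (by positivity), ENNReal.ofReal_one]
    _ ≤ _ := by
        refine ENNReal.ofReal_le_ofReal ?_
        have h1 : ∑ u, ((1 + d u + M.inDeg u : ℕ) : ℝ) ≤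
            Fintype.card V + (κ + 1) * M.numEdges := by
          rw [← M.sum_inDeg]
          push_cast
          rw [Finset.sum_add_distrib, Finset.sum_add_distrib, add_mul, one_mul, ← add_assoc,
            Finset.mul_sum]
          gcongr with u
          · simp
          · exact_mod_cast hd u
        have h2 : ∑ u : V, ((1 : ℕ) : ℝ) = Fintype.card V := by simp
        have h3 : 1 ≤ M.maxSpread / Fintype.card V * Fintype.card V := by
          rwa [div_mul_cancel₀ _ hn.ne']
        have h4 : 0 ≤ M.maxSpread / Fintype.card V := by positivity
        rw [h2]
        have h5 := mul_le_mul_of_nonneg_left h1 h4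
        have h6 : 0 ≤ M.maxSpread / Fintype.card V * M.numEdges := by positivity
        have h7 : 0 ≤ κ * (M.maxSpread / Fintype.card V * Fintype.card V) := by positivity
        linarith

end RRSet

/-! ### Inequalities for the exponential function -/

/-- Compare the exponential series with a geometric one, using `(k+2)! ≥ 2·3^k`. -/
theorem exp_sub_one_sub_le {x : ℝ} (h0 : 0 ≤ x) (h3 : x < 3) :
    Real.exp x - 1 - x ≤ x ^ 2 / (2 * (1 - x / 3)) := by
  have hs : HasSum (fun k : ℕ => x ^ (k + 2) / ((k + 2).factorial : ℝ)) (Real.exp x - 1 - x) := by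
    have h := NormedSpace.expSeries_div_hasSum_exp (𝔸 := ℝ) x
    rw [← Real.exp_eq_exp_ℝ] at h
    have := (hasSum_nat_add_iff' 2).2 h
    simpa [Finset.sum_range_succ, sub_sub] using this
  have hg : HasSum (fun k : ℕ => x ^ 2 / 2 * (x / 3) ^ k) (x ^ 2 / 2 * (1 - x / 3)⁻¹) :=
    (hasSum_geometric_of_lt_one (by positivity) (by linarith)).mul_left _
  have hf : ∀ k : ℕ, (2 * 3 ^ k : ℝ) ≤ (k + 2).factorial := by
    intro k
    have := Nat.factorial_mul_pow_le_factorial (m := 2) (n := k)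
    rw [add_comm 2 k] at this
    exact_mod_cast this
  refine (hasSum_le (fun k => ?_) hs hg).trans (le_of_eq ?_)
  · calc _ ≤ x ^ (k + 2) / (2 * 3 ^ k) := by
          gcongr
          exact hf k
      _ = _ := by rw [div_pow]; ring
  · rw [← div_eq_mul_inv, div_div]

/-- Equivalent to `x ≤ sinh x`. It reduces the lower tail to the exponent estimate of the upper
tail. -/
theorem exp_neg_sub_one_add_le {x : ℝ} (h0 : 0 ≤ x) :
    Real.exp (-x) - 1 + x ≤ Real.exp x - 1 - x := by
  have := Real.self_le_sinh_iff.2 h0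
  rw [Real.sinh_eq] at this
  linarith

theorem exp_mul_le_chord (l x : ℝ) (h0 : 0 ≤ x) (h1 : x ≤ 1) :
    Real.exp (l * x) ≤ 1 + (Real.exp l - 1) * x := by
  have := convexOn_exp.2 (Set.mem_univ 0) (Set.mem_univ l) (sub_nonneg.2 h1) h0 (by ring)
  simp only [smul_eq_mul, mul_zero, zero_add, Real.exp_zero] at this
  rw [mul_comm l]
  linarith

/-! ### Chernoff bounds and expected cost of the sampling loop -/

section Sampling

variable {V : Type} [Fintype V] [DecidableEq V] [Nonempty V]

theorem TriggeringModel.rrMean_contrib_nonneg (M : TriggeringModel V) (c : Centrality) (v : V) :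
    0 ≤ M.rrMean (c.contrib v) := by
  have h := M.rrMean_affine 0 0 (c.contrib v)
  simp only [zero_mul, add_zero] at h
  exact h.ge.trans (M.rrMean_mono (c.contrib_nonneg v))

/-- A contribution `X` in `[0,1]` with mean `p` has `E exp(lX) ≤ 1 + p(exp l - 1) ≤ exp(p(exp l -
1))` by convexity, for `l` of either sign; the factors of the fresh samples multiply. -/
theorem mean_sampleLoop_exp_le (M : TriggeringModel V) (d : V → ℕ) (c : Centrality) (v : V)
    (l : ℝ) (t : ℕ) (est : V → ℝ) :
    ((sampleLoop M d c.inc t est).mean fun e => ENNReal.ofReal (Real.exp (l * e v))) ≤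
      ENNReal.ofReal (Real.exp (l * est v + t * (M.rrMean (c.contrib v) * (Real.exp l - 1)))) := by
  induction t generalizing est with
  | zero => simp [sampleLoop, Timed.mean_pure]
  | succ t ih =>
    simp only [sampleLoop, Timed.mean_bind, Timed.mean_tick]
    refine (Timed.mean_mono _ fun R => ih _).trans ?_
    set p := M.rrMean (c.contrib v)
    have hR : ∀ R : Finset V, (if v ∈ R then est v + c.inc R else est v) =
        est v + c.contrib v R := by
      intro R
      unfold Centrality.contrib
      split_ifs <;> simp
    simp only [hR, mul_add, Real.exp_add _ (_ * (p * _)), Real.exp_add (l * est v)]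
    simp only [mul_assoc]
    rw [mean_rrSet_ofReal _ _ _ fun R => by positivity]
    refine ENNReal.ofReal_le_ofReal ?_
    have hb : ∀ R : Finset V, Real.exp (l * est v) * (Real.exp (l * c.contrib v R) *
        Real.exp (t * (p * (Real.exp l - 1)))) ≤
        Real.exp (l * est v) * Real.exp (t * (p * (Real.exp l - 1))) +
        Real.exp (l * est v) * Real.exp (t * (p * (Real.exp l - 1))) * (Real.exp l - 1) *
          c.contrib v R := by
      intro R
      have := exp_mul_le_chord l _ (c.contrib_nonneg v R) (c.contrib_le_one v R)
      calc _ = Real.exp (l * est v) * Real.exp (t * (p * (Real.exp l - 1))) *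
            Real.exp (l * c.contrib v R) := by ring
        _ ≤ Real.exp (l * est v) * Real.exp (t * (p * (Real.exp l - 1))) *
            (1 + (Real.exp l - 1) * c.contrib v R) := by gcongr
        _ = _ := by ring
    refine (M.rrMean_mono hb).trans ?_
    rw [M.rrMean_affine]
    have := Real.add_one_le_exp (p * (Real.exp l - 1))
    calc _ = Real.exp (l * est v) * Real.exp (t * (p * (Real.exp l - 1))) *
            (p * (Real.exp l - 1) + 1) := by ring
      _ ≤ Real.exp (l * est v) * Real.exp (t * (p * (Real.exp l - 1))) *
            Real.exp (p * (Real.exp l - 1)) := by gcongr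
      _ = _ := by
        rw [mul_assoc, ← Real.exp_add]
        congr 2
        push_cast
        ring

/-- The parameter `λ = δ/(1+δ/3)` satisfies `1 - λ/3 = 1/(1+δ/3)`, so the series bound turns into
`λδ/2 - λδ = -δ²/(2+2δ/3)`. -/
theorem bernstein_exponent_le {δ p : ℝ} (hδ : 0 < δ) (hp : 0 ≤ p) :
    p * (Real.exp (δ / (1 + δ / 3)) - 1 - δ / (1 + δ / 3) - δ / (1 + δ / 3) * δ) ≤
      -(p * δ ^ 2 / (2 + 2 / 3 * δ)) := by
  have h : δ / (1 + δ / 3) < 3 := by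
    rw [div_lt_iff₀ (by positivity)]
    linarith
  have := exp_sub_one_sub_le (x := δ / (1 + δ / 3)) (by positivity) h
  have h1 : 1 - δ / (1 + δ / 3) / 3 = 1 / (1 + δ / 3) := by
    field_simp
    ring
  rw [h1] at this
  calc _ ≤ p * ((δ / (1 + δ / 3)) ^ 2 / (2 * (1 / (1 + δ / 3))) - δ / (1 + δ / 3) * δ) := by
        gcongr
    _ = _ := by
      have h2 : 2 + 2 / 3 * δ = 2 * (1 + δ / 3) := by ring
      rw [h2]
      field_simp
      ring

/-- The upper Chernoff bound, with a deviation relative to an upper bound `p` of the mean. -/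
theorem prob_sampleLoop_ge_le (M : TriggeringModel V) (d : V → ℕ) (c : Centrality) (v : V)
    (t : ℕ) {δ p : ℝ} (hδ : 0 < δ) (hp : M.rrMean (c.contrib v) ≤ p) :
    ((sampleLoop M d c.inc t fun _ => 0).prob
      fun e => t * (M.rrMean (c.contrib v) + δ * p) ≤ e v) ≤
      ENNReal.ofReal (Real.exp (-(t * p * δ ^ 2 / (2 + 2 / 3 * δ)))) := by
  have hl : 0 ≤ δ / (1 + δ / 3) := by positivity
  have hp0 := M.rrMean_contrib_nonneg c v
  refine (Timed.prob_le_of_mean_exp _ _ (fun e => δ / (1 + δ / 3) * e v)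
    (δ / (1 + δ / 3) * (t * (M.rrMean (c.contrib v) + δ * p))) fun e he => by gcongr).trans ?_
  refine (mul_le_mul_right (mean_sampleLoop_exp_le M d c v _ t _) _).trans ?_
  rw [← ENNReal.ofReal_mul (Real.exp_pos _).le, ← Real.exp_add]
  refine ENNReal.ofReal_le_ofReal (Real.exp_le_exp.2 ?_)
  set m := M.rrMean (c.contrib v)
  have hb := bernstein_exponent_le hδ (hp0.trans hp)
  have hx : 0 ≤ Real.exp (δ / (1 + δ / 3)) - 1 - δ / (1 + δ / 3) := by
    linarith [Real.add_one_le_exp (δ / (1 + δ / 3))]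
  calc _ = t * (m * (Real.exp (δ / (1 + δ / 3)) - 1 - δ / (1 + δ / 3)) -
        p * (δ / (1 + δ / 3) * δ)) := by ring
    -- The true mean `m` multiplies a nonnegative quantity, so it may be replaced by its upper bound
    -- `p`.
    _ ≤ t * (p * (Real.exp (δ / (1 + δ / 3)) - 1 - δ / (1 + δ / 3)) -
        p * (δ / (1 + δ / 3) * δ)) := by gcongr
    _ = t * (p * (Real.exp (δ / (1 + δ / 3)) - 1 - δ / (1 + δ / 3) - δ / (1 + δ / 3) * δ)) := by
        ring
    _ ≤ t * -(p * δ ^ 2 / (2 + 2 / 3 * δ)) := by gcongr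
    _ = _ := by ring

/-- The lower Chernoff bound, with a deviation relative to an upper bound `p` of the mean. -/
theorem prob_sampleLoop_le_le (M : TriggeringModel V) (d : V → ℕ) (c : Centrality) (v : V)
    (t : ℕ) {δ p : ℝ} (hδ : 0 < δ) (hp : M.rrMean (c.contrib v) ≤ p) :
    ((sampleLoop M d c.inc t fun _ => 0).prob
      fun e => e v ≤ t * (M.rrMean (c.contrib v) - δ * p)) ≤
      ENNReal.ofReal (Real.exp (-(t * p * δ ^ 2 / (2 + 2 / 3 * δ)))) := by
  have hl : 0 ≤ δ / (1 + δ / 3) := by positivity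
  have hp0 := M.rrMean_contrib_nonneg c v
  refine (Timed.prob_le_of_mean_exp _ _ (fun e => -(δ / (1 + δ / 3)) * e v)
    (-(δ / (1 + δ / 3)) * (t * (M.rrMean (c.contrib v) - δ * p))) fun e he => ?_).trans ?_
  · exact mul_le_mul_of_nonpos_left he (neg_nonpos.2 hl)
  refine (mul_le_mul_right (mean_sampleLoop_exp_le M d c v _ t _) _).trans ?_
  rw [← ENNReal.ofReal_mul (Real.exp_pos _).le, ← Real.exp_add]
  refine ENNReal.ofReal_le_ofReal (Real.exp_le_exp.2 ?_)
  set m := M.rrMean (c.contrib v)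
  have hb := bernstein_exponent_le hδ (hp0.trans hp)
  have hx : 0 ≤ Real.exp (δ / (1 + δ / 3)) - 1 - δ / (1 + δ / 3) := by
    linarith [Real.add_one_le_exp (δ / (1 + δ / 3))]
  calc _ = t * (m * (Real.exp (-(δ / (1 + δ / 3))) - 1 + δ / (1 + δ / 3)) -
        p * (δ / (1 + δ / 3) * δ)) := by ring
    _ ≤ t * (m * (Real.exp (δ / (1 + δ / 3)) - 1 - δ / (1 + δ / 3)) -
        p * (δ / (1 + δ / 3) * δ)) := by
        gcongr
        exact exp_neg_sub_one_add_le hl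
    _ ≤ t * (p * (Real.exp (δ / (1 + δ / 3)) - 1 - δ / (1 + δ / 3)) -
        p * (δ / (1 + δ / 3) * δ)) := by gcongr
    _ = t * (p * (Real.exp (δ / (1 + δ / 3)) - 1 - δ / (1 + δ / 3) - δ / (1 + δ / 3) * δ)) := by
        ring
    _ ≤ t * -(p * δ ^ 2 / (2 + 2 / 3 * δ)) := by gcongr
    _ = _ := by ring

theorem mean_sampleLoop_add (M : TriggeringModel V) (d : V → ℕ) (inc : Finset V → ℝ)
    (f : (V → ℝ) → ENNReal) (s t : ℕ) (est : V → ℝ) :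
    (sampleLoop M d inc (s + t) est).mean f =
      (sampleLoop M d inc s est).mean fun e => (sampleLoop M d inc t e).mean f := by
  induction s generalizing est with
  | zero => simp [sampleLoop, Timed.mean_pure]
  | succ s ih =>
    rw [Nat.add_right_comm]
    simp only [sampleLoop, Timed.mean_bind, ih]

theorem prob_sampleLoop_add (M : TriggeringModel V) (d : V → ℕ) (inc : Finset V → ℝ)
    (P : (V → ℝ) → Prop) (s t : ℕ) (est : V → ℝ) :
    (sampleLoop M d inc (s + t) est).prob P =
      (sampleLoop M d inc s est).mean fun e => (sampleLoop M d inc t e).prob P := by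
  classical
  simp only [Timed.prob_eq_mean, mean_sampleLoop_add]

/-- Fresh RR sets have a cost independent of the current estimates; this plays the role of Wald's
identity for the random number of samples. -/
theorem expectedTime_sampleLoop (M : TriggeringModel V) (d : V → ℕ) (inc : Finset V → ℝ)
    (t : ℕ) (est : V → ℝ) :
    (sampleLoop M d inc t est).expectedTime =
      t * rrCost M d := by
  rw [rrCost]
  induction t generalizing est with
  | zero => simp [sampleLoop, Timed.expectedTime_pure]
  | succ t ih =>
    simp only [sampleLoop, Timed.expectedTime_bind, ih, Timed.expectedTime_tick,
      Timed.mean_add, Timed.mean_const]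
    push_cast
    ring

end Sampling

/-! ### Sample sizes against Chernoff exponents -/

/-- A sample size computed from `x` suffices whenever the relevant spread `y` is at least `x`. -/
theorem le_sample_exponent {t n A δ x y : ℝ} (hn : 0 < n) (hA : 0 ≤ A) (hδ : 0 < δ) (hx : 0 < x)
    (hxy : x ≤ y) (ht : n * A * (2 + 2 / 3 * δ) / (δ ^ 2 * x) ≤ t) :
    A ≤ t * (y / n) * δ ^ 2 / (2 + 2 / 3 * δ) := by
  rw [div_le_iff₀ (by positivity)] at ht
  rw [le_div_iff₀ (by positivity), show t * (y / n) * δ ^ 2 = t * y * δ ^ 2 / n by ring,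
    le_div_iff₀ hn]
  have ht0 : 0 ≤ t := by
    by_contra! h
    have h1 : 0 ≤ n * A * (2 + 2 / 3 * δ) := by positivity
    have h2 : t * (δ ^ 2 * x) < 0 := mul_neg_of_neg_of_pos h (by positivity)
    linarith
  calc _ = n * A * (2 + 2 / 3 * δ) := by ring
    _ ≤ t * (δ ^ 2 * x) := ht
    _ ≤ t * (δ ^ 2 * y) := by gcongr
    _ = _ := by ring

/-- The logarithmic factor in the number of RR sets of Phase 1. -/
noncomputable def logFactor1 (n : ℕ) (ℓ : ℝ) : ℝ :=
  (ℓ + 1) * Real.log n + Real.log (Real.logb 2 n) + Real.log 2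

/-- The logarithmic factor in the number of RR sets of Phase 2. -/
noncomputable def logFactor2 (n : ℕ) (ℓ : ℝ) : ℝ :=
  (ℓ + 1) * Real.log n + Real.log 4

theorem one_le_logb_two {n : ℕ} (hn : 2 ≤ n) : 1 ≤ Real.logb 2 n := by
  rw [Real.le_logb_iff_rpow_le (by norm_num) (by positivity), Real.rpow_one]
  exact_mod_cast hn

theorem logFactor1_nonneg {n : ℕ} {ℓ : ℝ} (hn : 2 ≤ n) (hℓ : 0 < ℓ) : 0 ≤ logFactor1 n ℓ := by
  have h1 := Real.log_nonneg (one_le_logb_two hn)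
  have h2 := Real.log_natCast_nonneg n
  have h3 := Real.log_nonneg (one_le_two : (1 : ℝ) ≤ 2)
  unfold logFactor1
  positivity

theorem logFactor2_pos (n : ℕ) {ℓ : ℝ} (hℓ : 0 < ℓ) : 0 < logFactor2 n ℓ := by
  have h2 := Real.log_natCast_nonneg n
  have h3 : 0 < Real.log 4 := Real.log_pos (by norm_num)
  unfold logFactor2
  positivity

theorem exp_neg_logFactor1 {n : ℕ} {ℓ : ℝ} (hn : 2 ≤ n) :
    Real.exp (-logFactor1 n ℓ) = 1 / ((n : ℝ) ^ ℓ * n * Real.logb 2 n * 2) := by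
  have hn' : (0 : ℝ) < n := by positivity
  have := one_le_logb_two hn
  rw [Real.exp_neg, logFactor1, Real.exp_add, Real.exp_add,
    Real.exp_log (zero_lt_one.trans_le this),
    Real.exp_log (by norm_num), mul_comm (ℓ + 1), ← Real.rpow_def_of_pos hn',
    Real.rpow_add_one hn'.ne', one_div]

theorem exp_neg_logFactor2 {n : ℕ} {ℓ : ℝ} (hn : 0 < n) :
    Real.exp (-logFactor2 n ℓ) = 1 / ((n : ℝ) ^ ℓ * n * 4) := by
  have hn' : (0 : ℝ) < n := by positivity
  rw [Real.exp_neg, logFactor2, Real.exp_add, Real.exp_log (by norm_num), mul_comm (ℓ + 1),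
    ← Real.rpow_def_of_pos hn', Real.rpow_add_one hn'.ne', one_div]

theorem theta1_of_ne_zero {n : ℕ} {ε ℓ : ℝ} {i : ℕ} (hi : i ≠ 0) :
    theta1 n ε ℓ i =
      ⌈(n * logFactor1 n ℓ * (2 + 2 / 3 * (√2 * ε))) / ((√2 * ε) ^ 2 * (n / 2 ^ i))⌉₊ :=
  if_neg hi

/-- Makes the truncated differences `theta1 i - theta1 (i - 1)` genuine, so that batches add up to
`theta1 i` samples. -/
theorem theta1_mono {n : ℕ} {ε ℓ : ℝ} (hn : 2 ≤ n) (hε : 0 < ε) (hℓ : 0 < ℓ) :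
    Monotone (theta1 n ε ℓ) := by
  intro i j hij
  by_cases hi : i = 0
  · simp [theta1, hi]
  · rw [theta1_of_ne_zero hi, theta1_of_ne_zero (by omega)]
    have := logFactor1_nonneg hn hℓ
    have hn' : (0 : ℝ) < n := by positivity
    gcongr
    norm_num

/-! ### Accuracy of the two phases -/

section Correctness

variable {V : Type} [Fintype V] [DecidableEq V] [Nonempty V]

/-- The test of iteration `i` of Phase 1. -/
def StopsAt (V : Type) [Fintype V] [Nonempty V] (ε ℓ : ℝ) (i : ℕ) (est : V → ℝ) : Prop :=
  Fintype.card V * Finset.univ.sup' Finset.univ_nonempty est / theta1 (Fintype.card V) ε ℓ i ≥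
    (1 + √2 * ε) * (Fintype.card V / 2 ^ i)

/-- The lower bound computed when Phase 1 stops in iteration `i`. -/
noncomputable def stopBound (V : Type) [Fintype V] [Nonempty V] (ε ℓ : ℝ) (i : ℕ)
    (est : V → ℝ) : ℝ :=
  Fintype.card V * Finset.univ.sup' Finset.univ_nonempty est /
    (theta1 (Fintype.card V) ε ℓ i * (1 + √2 * ε))

open scoped Classical in
theorem phase1Loop_succ (M : TriggeringModel V) (d : V → ℕ) (ε ℓ : ℝ) (r i : ℕ) (est : V → ℝ) :
    phase1Loop M d ε ℓ (r + 1) i est =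
      sampleLoop M d (fun _ => 1)
        (theta1 (Fintype.card V) ε ℓ i - theta1 (Fintype.card V) ε ℓ (i - 1)) est >>= fun est' =>
      Timed.tick (1 + Fintype.card V) >>= fun _ =>
      if StopsAt V ε ℓ i est' then pure (stopBound V ε ℓ i est')
      else phase1Loop M d ε ℓ r (i + 1) est' := by
  rw [phase1Loop]
  congr! 4

theorem StopsAt.le_stopBound {ε ℓ : ℝ} {i : ℕ} {est : V → ℝ} (hε : 0 < ε)
    (h : StopsAt V ε ℓ i est) : Fintype.card V / 2 ^ i ≤ stopBound V ε ℓ i est := by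
  rw [stopBound, ← div_div, le_div_iff₀ (by positivity), mul_comm]
  exact h

/-- Union bound over iterations without conditioning on survival: the estimates in iteration `i + j
+ 1` are compared with a sampling loop that never stops. If no test passes, the default `LB = 1` is
harmless as `1 ≤ σ`. -/
theorem prob_phase1Loop_bad_le (M : TriggeringModel V) (d : V → ℕ) {ε ℓ σ : ℝ} (hε : 0 < ε)
    (hσ : 1 ≤ σ) (hmono : Monotone (theta1 (Fintype.card V) ε ℓ)) (r i : ℕ) (est : V → ℝ) :
    (phase1Loop M d ε ℓ r (i + 1) est).prob (fun LB => ¬ (0 < LB ∧ LB ≤ σ)) ≤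
      ∑ j ∈ Finset.range r,
        (sampleLoop M d (fun _ => 1)
          (theta1 (Fintype.card V) ε ℓ (i + j + 1) - theta1 (Fintype.card V) ε ℓ i) est).prob
          fun e => StopsAt V ε ℓ (i + j + 1) e ∧ σ < stopBound V ε ℓ (i + j + 1) e := by
  classical
  induction r generalizing i est with
  | zero => simp [phase1Loop, Timed.prob_pure, hσ]
  | succ r ih =>
    rw [phase1Loop_succ, Timed.prob_bind]
    simp only [Timed.prob_bind, Timed.mean_tick, Nat.add_sub_cancel]
    rw [Finset.sum_range_succ']
    have hsum : ∀ j, theta1 (Fintype.card V) ε ℓ (i + (j + 1) + 1) - theta1 (Fintype.card V) ε ℓ i =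
        (theta1 (Fintype.card V) ε ℓ (i + 1) - theta1 (Fintype.card V) ε ℓ i) +
        (theta1 (Fintype.card V) ε ℓ (i + 1 + j + 1) - theta1 (Fintype.card V) ε ℓ (i + 1)) := by
      intro j
      have h1 := hmono (show i ≤ i + 1 by omega)
      have h2 := hmono (show i + 1 ≤ i + 1 + j + 1 by omega)
      rw [show i + (j + 1) + 1 = i + 1 + j + 1 by omega]
      omega
    simp only [hsum, prob_sampleLoop_add]
    rw [add_zero, Timed.prob_eq_mean, ← Timed.mean_finset_sum, ← Timed.mean_add]
    refine Timed.mean_mono _ fun e => ?_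
    split_ifs with hS hbad hbad
    · exact (Timed.prob_le_one _ _).trans le_add_self
    · rw [Timed.prob_pure, if_neg]
      · exact zero_le
      · rw [not_not]
        refine ⟨lt_of_lt_of_le ?_ (hS.le_stopBound hε), not_lt.1 fun h => hbad ⟨hS, h⟩⟩
        have : (0 : ℝ) < Fintype.card V := by exact_mod_cast Fintype.card_pos
        positivity
    · exact absurd hbad.1 hS
    · rw [add_zero]
      refine (ih (i + 1) e).trans (le_of_eq ?_)
      refine Finset.sum_congr rfl fun j _ => ?_
      rw [show i + (j + 1) + 1 = i + 1 + j + 1 by omega]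

/-- Both events together force some estimate above `(1+ε')y`, where `y` is the larger of `σ*` and
`x`. Since `y ≥ σ*` bounds all means and `y ≥ x`, the upper Chernoff bound applies to each node with
this sample size. -/
theorem prob_stops_too_high_le (M : TriggeringModel V) (d : V → ℕ) {ε ℓ : ℝ}
    (hn : 2 ≤ Fintype.card V) (hε : 0 < ε) (hℓ : 0 < ℓ) {i : ℕ} (hi : i ≠ 0) :
    (sampleLoop M d (fun _ => 1) (theta1 (Fintype.card V) ε ℓ i) fun _ => 0).prob
      (fun e => StopsAt V ε ℓ i e ∧ M.maxSpread < stopBound V ε ℓ i e) ≤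
      ENNReal.ofReal (1 / ((Fintype.card V : ℝ) ^ ℓ * Real.logb 2 (Fintype.card V) * 2)) := by
  set n := Fintype.card V with hn_def
  have hn0 : (0 : ℝ) < n := by positivity
  set y := max M.maxSpread (n / 2 ^ i) with hy
  have hδ : 0 < √2 * ε := by positivity
  have hyσ : M.maxSpread ≤ y := le_max_left _ _
  have hp : ∀ v, M.rrMean (Centrality.sni.contrib v) ≤ y / n := fun v =>
    (M.rrMean_contrib_le _ v).trans (by gcongr)
  have hA := logFactor1_nonneg hn hℓ
  calc _ ≤ (sampleLoop M d Centrality.sni.inc (theta1 n ε ℓ i) fun _ => 0).prob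
        (fun e => ∃ v, theta1 n ε ℓ i *
          (M.rrMean (Centrality.sni.contrib v) + √2 * ε * (y / n)) ≤ e v) := by
        refine Timed.prob_mono _ fun e ⟨h1, h2⟩ => ?_
        obtain ⟨v, -, hv⟩ := Finset.exists_mem_eq_sup' Finset.univ_nonempty e
        refine ⟨v, ?_⟩
        rw [stopBound, ← div_div, lt_div_iff₀ (by positivity)] at h2
        rw [StopsAt] at h1
        rw [hv] at h1 h2
        have h3 : (1 + √2 * ε) * y ≤ n * e v / theta1 n ε ℓ i := by
          rw [hy, mul_max_of_nonneg _ _ (by positivity)]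
          exact max_le (by rw [mul_comm]; exact h2.le) h1
        have hy0 : 0 < y := lt_of_lt_of_le (by positivity) (le_max_right _ _)
        -- Without samples the quotient would be `0` by convention, and the test could not pass.
        have hθ : (0 : ℝ) < theta1 n ε ℓ i := by
          rcases Nat.eq_zero_or_pos (theta1 n ε ℓ i) with h | h
          · rw [h, Nat.cast_zero, div_zero] at h3
            exact absurd h3 (not_le.2 (by positivity))
          · exact_mod_cast h
        rw [le_div_iff₀ hθ] at h3
        calc _ ≤ (theta1 n ε ℓ i : ℝ) * (y / n + √2 * ε * (y / n)) := by
              gcongr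
              exact hp v
          _ = ((1 + √2 * ε) * y * theta1 n ε ℓ i) / n := by ring
          _ ≤ (n * e v) / n := by gcongr
          _ = e v := by field_simp
    _ ≤ ∑ v : V, ENNReal.ofReal (Real.exp (-logFactor1 n ℓ)) := by
        refine (Timed.prob_exists_le _ _).trans (Finset.sum_le_sum fun v _ => ?_)
        refine (prob_sampleLoop_ge_le M d _ v _ hδ (hp v)).trans ?_
        refine ENNReal.ofReal_le_ofReal (Real.exp_le_exp.2 (neg_le_neg ?_))
        refine le_sample_exponent (x := n / 2 ^ i) hn0 hA hδ (by positivity) (le_max_right _ _) ?_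
        rw [theta1_of_ne_zero hi]
        exact Nat.le_ceil _
    _ = _ := by
        rw [Finset.sum_const, Finset.card_univ, nsmul_eq_mul, ← hn_def, ← ENNReal.ofReal_natCast,
          ← ENNReal.ofReal_mul (by positivity), exp_neg_logFactor1 hn]
        congr 1
        field_simp

theorem prob_phase1_bad_le (M : TriggeringModel V) (d : V → ℕ) {ε ℓ : ℝ} (hε : 0 < ε)
    (hℓ : 0 < ℓ) :
    (phase1 M d ε ℓ).prob (fun LB => ¬ (0 < LB ∧ LB ≤ M.maxSpread)) ≤
      ENNReal.ofReal (1 / ((Fintype.card V : ℝ) ^ ℓ * 2)) := by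
  classical
  rw [phase1, Timed.prob_bind, Timed.mean_tick]
  rcases lt_or_ge (Fintype.card V) 2 with hn | hn
  -- For `n = 1` the loop is empty and `LB = 1`.
  · rw [Nat.log_of_lt hn, phase1Loop, Timed.prob_pure, if_neg]
    · exact zero_le
    · simpa using M.one_le_maxSpread
  · refine (prob_phase1Loop_bad_le M d hε M.one_le_maxSpread (theta1_mono hn hε hℓ) _ 0 _).trans ?_
    have h0 : theta1 (Fintype.card V) ε ℓ 0 = 0 := if_pos rfl
    simp only [h0, Nat.sub_zero]
    refine (Finset.sum_le_card_nsmul _ _ _ fun j _ =>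
      prob_stops_too_high_le M d hn hε hℓ (Nat.succ_ne_zero _)).trans ?_
    have hlog := one_le_logb_two hn
    have hr : ((Nat.log 2 (Fintype.card V) - 1 : ℕ) : ℝ) ≤ Real.logb 2 (Fintype.card V) :=
      le_trans (Nat.cast_le.2 (Nat.sub_le _ _)) (by exact_mod_cast Real.natLog_le_logb _ _)
    have hn0 : (0 : ℝ) < Fintype.card V := by positivity
    rw [Finset.card_range, nsmul_eq_mul, ← ENNReal.ofReal_natCast,
      ← ENNReal.ofReal_mul (by positivity)]
    refine ENNReal.ofReal_le_ofReal ?_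
    calc _ ≤ Real.logb 2 (Fintype.card V) *
          (1 / ((Fintype.card V : ℝ) ^ ℓ * Real.logb 2 (Fintype.card V) * 2)) := by gcongr
      _ = _ := by field_simp

/-- The deviation `εσ*` is `ε` times the common bound `σ*/n` on the means, after scaling by `n`. The
`log 4` pays for two tails and for the final factor `1/2`. -/
theorem prob_phase2_bad_le (M : TriggeringModel V) (d : V → ℕ) (c : Centrality) {ε ℓ LB : ℝ}
    (hε : 0 < ε) (hℓ : 0 < ℓ) (hLB : 0 < LB) (hLBσ : LB ≤ M.maxSpread) :
    (phase2 M d c ε ℓ LB).prob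
      (fun ψ => ¬ ∀ v, |ψ v - M.centrality c v| ≤ ε * M.maxSpread) ≤
      ENNReal.ofReal (1 / ((Fintype.card V : ℝ) ^ ℓ * 2)) := by
  classical
  simp only [phase2, Timed.prob_bind, Timed.mean_tick, Timed.prob_pure]
  set n := Fintype.card V with hn_def
  have hn : 0 < n := Fintype.card_pos
  have hn0 : (0 : ℝ) < n := by exact_mod_cast hn
  have hA := logFactor2_pos n hℓ
  have hp : ∀ v, M.rrMean (c.contrib v) ≤ M.maxSpread / n := M.rrMean_contrib_le c
  have hceil : n * logFactor2 n ℓ * (2 + 2 / 3 * ε) / (ε ^ 2 * LB) ≤ theta2 n ε ℓ LB :=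
    Nat.le_ceil _
  have hθ : (0 : ℝ) < theta2 n ε ℓ LB := lt_of_lt_of_le (by positivity) hceil
  have hexp : Real.exp (-(theta2 n ε ℓ LB * (M.maxSpread / n) * ε ^ 2 / (2 + 2 / 3 * ε))) ≤
      Real.exp (-logFactor2 n ℓ) :=
    Real.exp_le_exp.2 (neg_le_neg (le_sample_exponent hn0 hA.le hε hLB hLBσ hceil))
  rw [← Timed.prob_eq_mean]
  calc _ ≤ (sampleLoop M d c.inc (theta2 n ε ℓ LB) fun _ => 0).prob (fun e => ∃ v,
        theta2 n ε ℓ LB * (M.rrMean (c.contrib v) + ε * (M.maxSpread / n)) ≤ e v ∨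
        e v ≤ theta2 n ε ℓ LB * (M.rrMean (c.contrib v) - ε * (M.maxSpread / n))) := by
        refine Timed.prob_mono _ fun e he => ?_
        push Not at he
        obtain ⟨v, hv⟩ := he
        refine ⟨v, ?_⟩
        rw [M.rrMean_contrib]
        rcases lt_abs.1 hv with h | h
        · left
          rw [lt_sub_iff_add_lt, lt_div_iff₀ hθ] at h
          calc _ = (ε * M.maxSpread + M.centrality c v) * theta2 n ε ℓ LB / n := by ring
            _ ≤ n * e v / n := by gcongr
            _ = e v := by field_simp
        · right
          rw [neg_sub, lt_sub_comm, div_lt_iff₀ hθ] at h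
          calc e v = n * e v / n := by field_simp
            _ ≤ (M.centrality c v - ε * M.maxSpread) * theta2 n ε ℓ LB / n := by gcongr
            _ = _ := by ring
    _ ≤ ∑ v : V, (ENNReal.ofReal (Real.exp (-logFactor2 n ℓ)) +
          ENNReal.ofReal (Real.exp (-logFactor2 n ℓ))) := by
        refine (Timed.prob_exists_le _ _).trans (Finset.sum_le_sum fun v _ => ?_)
        refine (Timed.prob_or_le _ _ _).trans (add_le_add ?_ ?_)
        · exact (prob_sampleLoop_ge_le M d _ v _ hε (hp v)).trans (ENNReal.ofReal_le_ofReal hexp)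
        · exact (prob_sampleLoop_le_le M d _ v _ hε (hp v)).trans (ENNReal.ofReal_le_ofReal hexp)
    _ = _ := by
        rw [Finset.sum_const, Finset.card_univ, nsmul_eq_mul, ← hn_def, ← ENNReal.ofReal_natCast,
          ← ENNReal.ofReal_add (by positivity) (by positivity),
          ← ENNReal.ofReal_mul (by positivity), exp_neg_logFactor2 hn]
        congr 1
        field_simp
        norm_num

theorem prob_rrAlgorithm_ge (M : TriggeringModel V) (d : V → ℕ) (c : Centrality) {ε ℓ : ℝ}
    (hε : 0 < ε) (hℓ : 0 < ℓ) :
    ENNReal.ofReal (1 - 1 / (Fintype.card V : ℝ) ^ ℓ) ≤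
      (rrAlgorithm M d c ε ℓ).prob
        (fun ψ => ∀ v, |ψ v - M.centrality c v| ≤ ε * M.maxSpread) := by
  classical
  have hn0 : (0 : ℝ) < Fintype.card V := by exact_mod_cast Fintype.card_pos
  rw [ENNReal.ofReal_sub _ (by positivity), ENNReal.ofReal_one, tsub_le_iff_right,
    ← Timed.prob_add_prob_not (rrAlgorithm M d c ε ℓ)
      (fun ψ => ∀ v, |ψ v - M.centrality c v| ≤ ε * M.maxSpread)]
  refine add_le_add_right ?_ _
  calc _ ≤ (phase1 M d ε ℓ).mean fun LB =>
        (if ¬ (0 < LB ∧ LB ≤ M.maxSpread) then 1 else 0) +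
          ENNReal.ofReal (1 / ((Fintype.card V : ℝ) ^ ℓ * 2)) := by
        rw [rrAlgorithm, Timed.prob_bind]
        refine Timed.mean_mono _ fun LB => ?_
        by_cases h : 0 < LB ∧ LB ≤ M.maxSpread
        · exact (prob_phase2_bad_le M d c hε hℓ h.1 h.2).trans le_add_self
        · rw [if_pos h]
          exact (Timed.prob_le_one _ _).trans le_self_add
    _ ≤ ENNReal.ofReal (1 / ((Fintype.card V : ℝ) ^ ℓ * 2)) +
          ENNReal.ofReal (1 / ((Fintype.card V : ℝ) ^ ℓ * 2)) := by
        rw [Timed.mean_add, Timed.mean_const, ← Timed.prob_eq_mean]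
        gcongr
        exact prob_phase1_bad_le M d hε hℓ
    _ = _ := by
        rw [← ENNReal.ofReal_add (by positivity) (by positivity)]
        congr 1
        field_simp
        norm_num

end Correctness

/-! ### Expected cost of the adaptive sampling -/

section RunningTime

variable {V : Type} [Fintype V] [DecidableEq V] [Nonempty V]

/-- The expected time of the loop of Phase 1 and of the RR sets of Phase 2. -/
noncomputable def loopCost (M : TriggeringModel V) (d : V → ℕ) (ε ℓ : ℝ) (r i : ℕ)
    (est : V → ℝ) : ENNReal :=
  (phase1Loop M d ε ℓ r i est).expectedTime +
    (phase1Loop M d ε ℓ r i est).mean fun LB => theta2 (Fintype.card V) ε ℓ LB * rrCost M d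

theorem theta2_anti {n : ℕ} {ε ℓ x y : ℝ} (hε : 0 < ε) (hℓ : 0 < ℓ) (hx : 0 < x) (hxy : x ≤ y) :
    theta2 n ε ℓ y ≤ theta2 n ε ℓ x := by
  have := (logFactor2_pos n hℓ).le
  unfold logFactor2 at this
  unfold theta2
  gcongr

theorem expectedTime_phase2 (M : TriggeringModel V) (d : V → ℕ) (c : Centrality) (ε ℓ LB : ℝ) :
    (phase2 M d c ε ℓ LB).expectedTime =
      ((1 + 2 * Fintype.card V : ℕ) : ENNReal) + theta2 (Fintype.card V) ε ℓ LB * rrCost M d := by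
  simp only [phase2, Timed.expectedTime_bind, Timed.expectedTime_tick,
    Timed.expectedTime_pure, expectedTime_sampleLoop, Timed.mean_const]
  push_cast
  ring

theorem expectedTime_rrAlgorithm (M : TriggeringModel V) (d : V → ℕ) (c : Centrality) (ε ℓ : ℝ) :
    (rrAlgorithm M d c ε ℓ).expectedTime = ((2 + 3 * Fintype.card V : ℕ) : ENNReal) +
      loopCost M d ε ℓ (Nat.log 2 (Fintype.card V) - 1) 1 fun _ => 0 := by
  simp only [rrAlgorithm, Timed.expectedTime_bind, expectedTime_phase2, Timed.mean_add,
    Timed.mean_const, phase1, Timed.expectedTime_tick, Timed.mean_bind, loopCost]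
  push_cast
  ring

open scoped Classical in
-- Adding the cost of the `theta1 i` samples already drawn telescopes the batches: whoever stops at
-- iteration `i + 1` has paid for `theta1 (i + 1)` samples in all.
theorem loopCost_succ (M : TriggeringModel V) (d : V → ℕ) {ε ℓ : ℝ}
    (hmono : Monotone (theta1 (Fintype.card V) ε ℓ)) (r i : ℕ) (est : V → ℝ) :
    loopCost M d ε ℓ (r + 1) (i + 1) est + theta1 (Fintype.card V) ε ℓ i * rrCost M d =
      (sampleLoop M d (fun _ => 1)
        (theta1 (Fintype.card V) ε ℓ (i + 1) - theta1 (Fintype.card V) ε ℓ i) est).mean fun e =>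
          ((1 + Fintype.card V : ℕ) : ENNReal) + (theta1 (Fintype.card V) ε ℓ (i + 1) * rrCost M d +
          if StopsAt V ε ℓ (i + 1) e then
            theta2 (Fintype.card V) ε ℓ (stopBound V ε ℓ (i + 1) e) * rrCost M d
          else loopCost M d ε ℓ r (i + 2) e) := by
  have hθ : (theta1 (Fintype.card V) ε ℓ (i + 1) : ENNReal) =
      (theta1 (Fintype.card V) ε ℓ (i + 1) - theta1 (Fintype.card V) ε ℓ i : ℕ) +
        theta1 (Fintype.card V) ε ℓ i := by
    rw [← Nat.cast_add, Nat.sub_add_cancel (hmono (Nat.le_succ i))]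
  have hite : ∀ e, (if StopsAt V ε ℓ (i + 1) e then
        theta2 (Fintype.card V) ε ℓ (stopBound V ε ℓ (i + 1) e) * rrCost M d
        else loopCost M d ε ℓ r (i + 2) e) =
      (if StopsAt V ε ℓ (i + 1) e then pure (stopBound V ε ℓ (i + 1) e)
        else phase1Loop M d ε ℓ r (i + 2) e).expectedTime +
      (if StopsAt V ε ℓ (i + 1) e then pure (stopBound V ε ℓ (i + 1) e)
        else phase1Loop M d ε ℓ r (i + 2) e).mean
          fun LB => theta2 (Fintype.card V) ε ℓ LB * rrCost M d := by
    intro e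
    split_ifs
    · rw [Timed.expectedTime_pure, Timed.mean_pure, zero_add]
    · rfl
  simp only [hite, Timed.mean_add, Timed.mean_const]
  rw [loopCost, phase1Loop_succ, hθ]
  simp only [Timed.expectedTime_bind, Timed.mean_bind, Timed.expectedTime_tick,
    expectedTime_sampleLoop, Timed.mean_add, Timed.mean_const, Nat.add_sub_cancel]
  ring_nf

/-- Worst case: `hir` keeps every `x` at least `1`, so each possible `LB` is at least `1` and Phase
2 draws at most `theta2 1` sets. -/
theorem loopCost_le (M : TriggeringModel V) (d : V → ℕ) {ε ℓ : ℝ} (hε : 0 < ε) (hℓ : 0 < ℓ)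
    (hmono : Monotone (theta1 (Fintype.card V) ε ℓ)) (r i : ℕ) (est : V → ℝ)
    (hir : 2 ^ (i + r) ≤ Fintype.card V) :
    loopCost M d ε ℓ r (i + 1) est + theta1 (Fintype.card V) ε ℓ i * rrCost M d ≤
      ((r * (1 + Fintype.card V) : ℕ) : ENNReal) +
        (theta1 (Fintype.card V) ε ℓ (i + r) + theta2 (Fintype.card V) ε ℓ 1) * rrCost M d := by
  classical
  induction r generalizing i est with
  | zero =>
    rw [loopCost, phase1Loop, Timed.expectedTime_pure, Timed.mean_pure]
    refine le_of_eq ?_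
    push_cast
    ring_nf
  | succ r ih =>
    rw [loopCost_succ M d hmono]
    refine (Timed.mean_mono _ (g := fun _ => _) fun e => ?_).trans (Timed.mean_const _ _).le
    have hsplit : (((r + 1) * (1 + Fintype.card V) : ℕ) : ENNReal) =
        ((1 + Fintype.card V : ℕ) : ENNReal) + ((r * (1 + Fintype.card V) : ℕ) : ENNReal) := by
      push_cast
      ring
    rw [hsplit, add_assoc]
    refine add_le_add_right ?_ _
    split_ifs with hS
    · refine le_trans ?_ le_add_self
      rw [← add_mul]
      have h1 : (theta1 (Fintype.card V) ε ℓ (i + 1) : ENNReal) ≤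
          theta1 (Fintype.card V) ε ℓ (i + (r + 1)) := by
        exact_mod_cast hmono (by omega)
      have h2 : (theta2 (Fintype.card V) ε ℓ (stopBound V ε ℓ (i + 1) e) : ENNReal) ≤
          theta2 (Fintype.card V) ε ℓ 1 := by
        refine Nat.cast_le.2 (theta2_anti hε hℓ one_pos (le_trans ?_ (hS.le_stopBound hε)))
        rw [le_div_iff₀ (by positivity), one_mul]
        refine le_trans ?_ (Nat.cast_le.2 hir)
        push_cast
        exact pow_le_pow_right₀ one_le_two (by omega)
      gcongr
    · rw [add_comm]
      have := ih (i + 1) e (by rwa [show i + 1 + r = i + (r + 1) by omega])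
      rwa [show i + 1 + r = i + (r + 1) by omega] at this

/-- Either the loop stops by iteration `i + k + 1`, or the test there fails, and then the worst-case
bound is charged. The failure probability is that of the loop that never stops. -/
theorem loopCost_le_of_stopsAt (M : TriggeringModel V) (d : V → ℕ) {ε ℓ : ℝ} (hε : 0 < ε)
    (hℓ : 0 < ℓ) (hmono : Monotone (theta1 (Fintype.card V) ε ℓ)) (k r i : ℕ) (est : V → ℝ)
    (hkr : k < r) (hir : 2 ^ (i + r) ≤ Fintype.card V) :
    loopCost M d ε ℓ r (i + 1) est + theta1 (Fintype.card V) ε ℓ i * rrCost M d ≤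
      ((r * (1 + Fintype.card V) : ℕ) : ENNReal) +
        ((theta1 (Fintype.card V) ε ℓ (i + k + 1) +
          theta2 (Fintype.card V) ε ℓ (Fintype.card V / 2 ^ (i + k + 1))) * rrCost M d +
        (theta1 (Fintype.card V) ε ℓ (i + r) + theta2 (Fintype.card V) ε ℓ 1) * rrCost M d *
          (sampleLoop M d (fun _ => 1)
            (theta1 (Fintype.card V) ε ℓ (i + k + 1) - theta1 (Fintype.card V) ε ℓ i) est).prob
              fun e => ¬ StopsAt V ε ℓ (i + k + 1) e) := by
  classical
  have hn0 : (0 : ℝ) < Fintype.card V := by exact_mod_cast Fintype.card_pos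
  -- An earlier stop is cheaper: fewer samples so far, and a lower bound of at least `n / 2 ^ i ≥ n
  -- / 2 ^ j`.
  have hSle : ∀ (i j : ℕ) (e : V → ℝ), StopsAt V ε ℓ i e → i ≤ j →
      theta1 (Fintype.card V) ε ℓ i * rrCost M d +
        theta2 (Fintype.card V) ε ℓ (stopBound V ε ℓ i e) * rrCost M d ≤
      (theta1 (Fintype.card V) ε ℓ j +
        theta2 (Fintype.card V) ε ℓ (Fintype.card V / 2 ^ j)) * rrCost M d := by
    intro i j e hS hij
    rw [← add_mul]
    have h1 : (theta1 (Fintype.card V) ε ℓ i : ENNReal) ≤ theta1 (Fintype.card V) ε ℓ j := by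
      exact_mod_cast hmono hij
    have h2 : (theta2 (Fintype.card V) ε ℓ (stopBound V ε ℓ i e) : ENNReal) ≤
        theta2 (Fintype.card V) ε ℓ (Fintype.card V / 2 ^ j) := by
      refine Nat.cast_le.2 (theta2_anti hε hℓ (by positivity)
        (le_trans ?_ (hS.le_stopBound hε)))
      gcongr
      norm_num
    gcongr
  obtain ⟨r, rfl⟩ := Nat.exists_eq_succ_of_ne_zero (by omega : r ≠ 0)
  rw [Nat.succ_eq_add_one] at *
  have hsplit : ∀ r : ℕ, (((r + 1) * (1 + Fintype.card V) : ℕ) : ENNReal) =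
      ((1 + Fintype.card V : ℕ) : ENNReal) + ((r * (1 + Fintype.card V) : ℕ) : ENNReal) := by
    intro r
    push_cast
    ring
  induction k generalizing r i est with
  | zero =>
    rw [loopCost_succ M d hmono, Timed.prob_eq_mean, ← Timed.mean_mul_left, add_zero,
      ← Timed.mean_const (sampleLoop M d (fun _ => 1) _ est)
        ((((r + 1) * (1 + Fintype.card V) : ℕ) : ENNReal)),
      ← Timed.mean_const (sampleLoop M d (fun _ => 1) _ est) ((_ + _) * rrCost M d),
      ← Timed.mean_add, ← Timed.mean_add]
    refine Timed.mean_mono _ fun e => ?_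
    rw [hsplit, add_assoc]
    refine add_le_add_right ?_ _
    split_ifs with hS
    · refine le_trans ?_ le_add_self
      rw [mul_zero, add_zero]
      exact hSle _ _ _ hS le_rfl
    · rw [add_comm, mul_one]
      have := loopCost_le M d hε hℓ hmono r (i + 1) e
        (by rwa [show i + 1 + r = i + (r + 1) by omega])
      rw [show i + 1 + r = i + (r + 1) by omega] at this
      refine this.trans (add_le_add_right ?_ _)
      exact le_add_self
  | succ k ih =>
    have hsum : theta1 (Fintype.card V) ε ℓ (i + (k + 1) + 1) - theta1 (Fintype.card V) ε ℓ i =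
        (theta1 (Fintype.card V) ε ℓ (i + 1) - theta1 (Fintype.card V) ε ℓ i) +
        (theta1 (Fintype.card V) ε ℓ (i + 1 + k + 1) - theta1 (Fintype.card V) ε ℓ (i + 1)) := by
      have h1 := hmono (show i ≤ i + 1 by omega)
      have h2 := hmono (show i + 1 ≤ i + 1 + k + 1 by omega)
      rw [show i + (k + 1) + 1 = i + 1 + k + 1 by omega]
      omega
    rw [loopCost_succ M d hmono, hsum, prob_sampleLoop_add, ← Timed.mean_mul_left,
      ← Timed.mean_const (sampleLoop M d (fun _ => 1) _ est)
        ((((r + 1) * (1 + Fintype.card V) : ℕ) : ENNReal)),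
      ← Timed.mean_const (sampleLoop M d (fun _ => 1) _ est) ((_ + _) * rrCost M d),
      ← Timed.mean_add, ← Timed.mean_add]
    refine Timed.mean_mono _ fun e => ?_
    rw [hsplit, add_assoc]
    refine add_le_add_right ?_ _
    split_ifs with hS
    · refine le_trans ?_ le_add_self
      exact (hSle _ _ _ hS (by omega)).trans le_self_add
    · rw [add_comm]
      obtain ⟨r, rfl⟩ := Nat.exists_eq_succ_of_ne_zero (by omega : r ≠ 0)
      have := ih (i + 1) e r (by omega) (by rwa [show i + 1 + (r + 1) = i + (r + 1 + 1) by omega])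
      rw [show i + 1 + (r + 1) = i + (r + 1 + 1) by omega] at this
      rwa [show i + (k + 1) + 1 = i + 1 + k + 1 by omega]

/-- A node of largest spread fails the test only if its estimate is below `(1+a)x ≤ σ*/(1+a)`, a
relative deviation `a/(1+a)` for `a = ε'`. The factor `(1+a)²` in `hσ` makes up for the smaller
deviation in the exponent. -/
theorem prob_not_stopsAt_le (M : TriggeringModel V) (d : V → ℕ) {ε ℓ : ℝ}
    (hn : 2 ≤ Fintype.card V) (hε : 0 < ε) (hℓ : 0 < ℓ) {i : ℕ} (hi : i ≠ 0)
    (hσ : (1 + √2 * ε) ^ 2 * (Fintype.card V / 2 ^ i) ≤ M.maxSpread) :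
    (sampleLoop M d (fun _ => 1) (theta1 (Fintype.card V) ε ℓ i) fun _ => 0).prob
      (fun e => ¬ StopsAt V ε ℓ i e) ≤ ENNReal.ofReal (1 / Fintype.card V) := by
  set n := Fintype.card V with hn_def
  have hn0 : (0 : ℝ) < n := by positivity
  have hn1 : (1 : ℝ) < n := by exact_mod_cast hn
  set a := √2 * ε with ha_def
  have ha : 0 < a := by positivity
  have hσ1 := M.one_le_maxSpread
  obtain ⟨v, hv⟩ := M.exists_spread_eq_maxSpread
  have hp : M.rrMean (Centrality.sni.contrib v) = M.maxSpread / n := by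
    rw [M.rrMean_contrib, ← hv]
    rfl
  have hA : 0 < logFactor1 n ℓ := by
    have h1 := Real.log_nonneg (one_le_logb_two hn)
    have h2 := Real.log_pos hn1
    have h3 := Real.log_nonneg (one_le_two : (1 : ℝ) ≤ 2)
    unfold logFactor1
    positivity
  have hceil : n * logFactor1 n ℓ * (2 + 2 / 3 * a) / (a ^ 2 * (n / 2 ^ i)) ≤
      theta1 n ε ℓ i := by
    rw [theta1_of_ne_zero hi]
    exact Nat.le_ceil _
  have hθ : (0 : ℝ) < theta1 n ε ℓ i := lt_of_lt_of_le (by positivity) hceil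
  calc _ ≤ (sampleLoop M d Centrality.sni.inc (theta1 n ε ℓ i) fun _ => 0).prob
        (fun e => e v ≤ theta1 n ε ℓ i *
          (M.rrMean (Centrality.sni.contrib v) - a / (1 + a) * (M.maxSpread / n))) := by
        refine Timed.prob_mono _ fun e he => ?_
        rw [StopsAt, ge_iff_le, not_le, div_lt_iff₀ hθ, ← hn_def, ← ha_def] at he
        have h1 : e v ≤ Finset.univ.sup' Finset.univ_nonempty e :=
          Finset.le_sup' e (Finset.mem_univ v)
        rw [hp]
        calc e v = n * e v / n := by field_simp
          _ ≤ n * Finset.univ.sup' Finset.univ_nonempty e / n := by gcongr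
          _ ≤ (1 + a) * (n / 2 ^ i) * theta1 n ε ℓ i / n := by gcongr
          _ = (1 + a) ^ 2 * (n / 2 ^ i) * theta1 n ε ℓ i / n / (1 + a) := by
            field_simp
          _ ≤ M.maxSpread * theta1 n ε ℓ i / n / (1 + a) := by gcongr
          _ = _ := by
            field_simp
            ring
    _ ≤ ENNReal.ofReal (Real.exp (-logFactor1 n ℓ)) := by
        refine (prob_sampleLoop_le_le M d _ v _ (by positivity) hp.le).trans ?_
        refine ENNReal.ofReal_le_ofReal (Real.exp_le_exp.2 (neg_le_neg ?_))
        refine (le_sample_exponent hn0 hA.le ha (by positivity) le_rfl hceil).trans ?_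
        have h1 : a / (1 + a) ≤ a := div_le_self ha.le (by linarith)
        calc _ ≤ theta1 n ε ℓ i * (n / 2 ^ i / n) * a ^ 2 / (2 + 2 / 3 * (a / (1 + a))) := by
              gcongr
          _ = theta1 n ε ℓ i * ((1 + a) ^ 2 * (n / 2 ^ i) / n) * (a / (1 + a)) ^ 2 /
                (2 + 2 / 3 * (a / (1 + a))) := by
              congr 1
              field_simp
          _ ≤ _ := by gcongr
    _ ≤ _ := by
        refine ENNReal.ofReal_le_ofReal ?_
        rw [exp_neg_logFactor1 hn]
        have h1 := one_le_logb_two hn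
        have h2 : 1 ≤ (n : ℝ) ^ ℓ := Real.one_le_rpow hn1.le hℓ.le
        refine one_div_le_one_div_of_le hn0 ?_
        calc (n : ℝ) = 1 * n * 1 * 1 := by ring
          _ ≤ _ := by gcongr; norm_num

end RunningTime

/-! ### Sample sizes in terms of the sampling rate -/

theorem add_three_mul_log_le {n : ℕ} {ℓ ℓ₀ : ℝ} (hℓ₀ : 0 < ℓ₀) (hℓ : ℓ₀ ≤ ℓ) :
    (ℓ + 3) * Real.log n ≤ (1 + 3 / ℓ₀) * (ℓ * Real.log n) := by
  rw [← mul_assoc]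
  refine mul_le_mul_of_nonneg_right ?_ (Real.log_natCast_nonneg n)
  have : 3 ≤ 3 / ℓ₀ * ℓ := by
    rw [div_mul_eq_mul_div, le_div_iff₀ hℓ₀]
    linarith
  linarith

theorem logFactor1_le {n : ℕ} {ℓ : ℝ} (hn : 2 ≤ n) : logFactor1 n ℓ ≤ (ℓ + 3) * Real.log n := by
  have hn2 : (2 : ℝ) ≤ n := by exact_mod_cast hn
  have h1 := one_le_logb_two hn
  have h2 : Real.logb 2 n ≤ n := by
    rw [Real.logb_le_iff_le_rpow one_lt_two (by positivity), Real.rpow_natCast]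
    exact_mod_cast Nat.lt_two_pow_self.le
  have h3 := Real.log_le_log (by linarith) h2
  have h4 := Real.log_le_log two_pos hn2
  unfold logFactor1
  linarith

theorem logFactor2_le {n : ℕ} {ℓ : ℝ} (hn : 2 ≤ n) : logFactor2 n ℓ ≤ (ℓ + 3) * Real.log n := by
  have hn2 : (2 : ℝ) ≤ n := by exact_mod_cast hn
  have h4 := Real.log_le_log two_pos hn2
  have h5 : Real.log 4 = 2 * Real.log 2 := by
    rw [show (4 : ℝ) = 2 ^ 2 by norm_num, Real.log_pow]
    norm_num
  unfold logFactor2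
  linarith

/-- A bound for the number of RR sets divided by `n / x`. -/
noncomputable def sampleRate (n : ℕ) (ε ℓ ε₀ ℓ₀ : ℝ) : ℝ :=
  (1 + 3 / ℓ₀) * (2 + ε₀) * (ℓ * Real.log n / ε ^ 2)

theorem theta1_le {n : ℕ} {ε ℓ ε₀ ℓ₀ : ℝ} (hn : 2 ≤ n) (hε : 0 < ε) (hε₀ : ε ≤ ε₀) (hℓ₀ : 0 < ℓ₀)
    (hℓ : ℓ₀ ≤ ℓ) (i : ℕ) :
    (theta1 n ε ℓ i : ℝ) ≤ 1 + n * sampleRate n ε ℓ ε₀ ℓ₀ / (n / 2 ^ i) := by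
  have hn0 : (0 : ℝ) < n := by positivity
  have hl := Real.log_natCast_nonneg n
  have hε₀' : 0 < ε₀ := hε.trans_le hε₀
  have hℓ' : 0 < ℓ := hℓ₀.trans_le hℓ
  by_cases hi : i = 0
  · rw [theta1, if_pos hi, Nat.cast_zero, sampleRate]
    positivity
  · rw [theta1_of_ne_zero hi]
    have hA := logFactor1_nonneg hn hℓ'
    refine (Nat.ceil_lt_add_one (by positivity)).le.trans ?_
    rw [add_comm]
    refine add_le_add_right ?_ _
    have hs : √2 ^ 2 = (2 : ℝ) := Real.sq_sqrt (by norm_num)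
    have hs' : √2 ≤ 3 / 2 := Real.sqrt_le_iff.2 (by norm_num)
    have h1 : 2 + 2 / 3 * (√2 * ε) ≤ 2 + ε₀ := by
      have := mul_le_mul_of_nonneg_right hs' hε.le
      linarith
    have h2 : ε ^ 2 ≤ (√2 * ε) ^ 2 := by
      rw [mul_pow, hs]
      linarith [sq_nonneg ε]
    have h3 := (logFactor1_le (ℓ := ℓ) hn).trans (add_three_mul_log_le hℓ₀ hℓ)
    calc _ ≤ n * ((1 + 3 / ℓ₀) * (ℓ * Real.log n)) * (2 + ε₀) / (ε ^ 2 * (n / 2 ^ i)) := by gcongr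
      _ = _ := by
        rw [sampleRate]
        field_simp

theorem theta2_le {n : ℕ} {ε ℓ ε₀ ℓ₀ x : ℝ} (hn : 2 ≤ n) (hε : 0 < ε) (hε₀ : ε ≤ ε₀) (hℓ₀ : 0 < ℓ₀)
    (hℓ : ℓ₀ ≤ ℓ) (hx : 0 < x) :
    (theta2 n ε ℓ x : ℝ) ≤ 1 + n * sampleRate n ε ℓ ε₀ ℓ₀ / x := by
  have hn0 : (0 : ℝ) < n := by positivity
  have hl := Real.log_natCast_nonneg n
  have hε₀' : 0 < ε₀ := hε.trans_le hε₀
  have hℓ' : 0 < ℓ := hℓ₀.trans_le hℓ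
  have hA := (logFactor2_pos n hℓ').le
  change ((⌈(n * logFactor2 n ℓ * (2 + 2 / 3 * ε)) / (ε ^ 2 * x)⌉₊ : ℕ) : ℝ) ≤ _
  refine (Nat.ceil_lt_add_one (by positivity)).le.trans ?_
  rw [add_comm]
  refine add_le_add_right ?_ _
  have h1 : 2 + 2 / 3 * ε ≤ 2 + ε₀ := by linarith
  have h3 := (logFactor2_le (ℓ := ℓ) hn).trans (add_three_mul_log_le hℓ₀ hℓ)
  calc _ ≤ n * ((1 + 3 / ℓ₀) * (ℓ * Real.log n)) * (2 + ε₀) / (ε ^ 2 * x) := by gcongr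
    _ = _ := by
      rw [sampleRate]
      field_simp

/-! ### Expected number of RR sets and total time -/

section RunningTime

variable {V : Type} [Fintype V] [DecidableEq V] [Nonempty V]

theorem ENNReal.natCast_add_natCast_le_ofReal {a b : ℕ} {x : ℝ} (h : (a : ℝ) + b ≤ x) :
    (a : ENNReal) + b ≤ ENNReal.ofReal x := by
  rw [← Nat.cast_add, ← ENNReal.ofReal_natCast]
  exact ENNReal.ofReal_le_ofReal (by exact_mod_cast h)

/-- The expected number of RR sets is `O(n Q / σ*)`, where `Q` is the sampling rate. -/
theorem loopCost_phase1_le (M : TriggeringModel V) (d : V → ℕ) {ε ℓ ε₀ ℓ₀ : ℝ}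
    (hn : 2 ≤ Fintype.card V) (hε : 0 < ε) (hε₀ : ε ≤ ε₀) (hℓ₀ : 0 < ℓ₀) (hℓ : ℓ₀ ≤ ℓ) :
    loopCost M d ε ℓ (Nat.log 2 (Fintype.card V) - 1) 1 (fun _ => 0) ≤
      (((Nat.log 2 (Fintype.card V) - 1) * (1 + Fintype.card V) : ℕ) : ENNReal) +
        ENNReal.ofReal (4 + 10 * (1 + √2 * ε) ^ 2 * sampleRate (Fintype.card V) ε ℓ ε₀ ℓ₀ *
          (Fintype.card V / M.maxSpread)) * rrCost M d := by
  have hℓ' : 0 < ℓ := hℓ₀.trans_le hℓ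
  have hε₀' : 0 < ε₀ := hε.trans_le hε₀
  have hmono := theta1_mono hn hε hℓ'
  have hσ := M.one_le_maxSpread
  have hσn := M.maxSpread_le_card
  have hT1 := theta1_le hn hε hε₀ hℓ₀ hℓ
  have hT2 : ∀ x : ℝ, 0 < x → _ := fun x hx => theta2_le hn hε hε₀ hℓ₀ hℓ hx
  have hQ : 0 ≤ sampleRate (Fintype.card V) ε ℓ ε₀ ℓ₀ := by
    have hl := Real.log_natCast_nonneg (Fintype.card V)
    unfold sampleRate
    positivity
  have hE1 : 1 ≤ (1 + √2 * ε) ^ 2 := one_le_pow₀ (le_add_of_nonneg_right (by positivity))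
  have hE2 : 1 < (1 + √2 * ε) ^ 2 := one_lt_pow₀ (lt_add_of_pos_right _ (by positivity)) two_ne_zero
  have hr1 : 2 ^ (0 + (Nat.log 2 (Fintype.card V) - 1)) ≤ Fintype.card V := by
    rw [zero_add]
    exact (Nat.pow_le_pow_right two_pos (Nat.sub_le _ _)).trans (Nat.pow_log_le_self 2 (by omega))
  have hr2 : Fintype.card V < 4 * 2 ^ (Nat.log 2 (Fintype.card V) - 1) := by
    have h1 := Nat.lt_pow_succ_log_self one_lt_two (Fintype.card V)
    have h2 : 1 ≤ Nat.log 2 (Fintype.card V) := Nat.log_pos one_lt_two hn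
    rw [show (4 : ℕ) = 2 ^ 2 by norm_num, ← pow_add]
    rwa [show 2 + (Nat.log 2 (Fintype.card V) - 1) = (Nat.log 2 (Fintype.card V)).succ by omega]
  have h0 : theta1 (Fintype.card V) ε ℓ 0 = 0 := if_pos rfl
  set n := Fintype.card V with hn_def
  set r := Nat.log 2 n - 1
  set Q := sampleRate n ε ℓ ε₀ ℓ₀
  set E := (1 + √2 * ε) ^ 2
  set σ := M.maxSpread
  have hn0 : (0 : ℝ) < n := by positivity
  have hσ0 : 0 < σ := by linarith
  have hn1 : 1 ≤ n / σ := by rwa [one_le_div hσ0]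
  -- With `r = ⌊log₂ n⌋ - 1`, the last threshold `x` lies between `1` and `4`.
  have hxr : 1 ≤ (n : ℝ) / 2 ^ r := by
    rw [one_le_div (by positivity)]
    rw [zero_add] at hr1
    exact_mod_cast hr1
  have hxr4 : (n : ℝ) / 2 ^ r ≤ 4 := by
    rw [div_le_iff₀ (by positivity)]
    exact_mod_cast hr2.le
  have hlast : (theta1 n ε ℓ r : ℝ) + theta2 n ε ℓ 1 ≤ 2 + 2 * (n * Q) := by
    have h1 := hT1 r
    have h2 := hT2 1 one_pos
    have h3 : n * Q / ((n : ℝ) / 2 ^ r) ≤ n * Q := div_le_self (by positivity) hxr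
    rw [div_one] at h2
    linarith
  have hEQ : 0 ≤ E * Q * (n / σ) := by positivity
  have hQE : Q ≤ E * Q * (n / σ) := by
    calc Q = 1 * Q * 1 := by ring
      _ ≤ _ := by gcongr
  -- Is there an iteration that almost surely passes its test, in the sense of failing with
  -- probability at most `1/n`? Take the first one, `a`.
  by_cases h : ∃ a, a ≤ r ∧ E * (n / 2 ^ a) ≤ σ
  · classical
    obtain ⟨har, haσ⟩ := Nat.find_spec h
    have hmin := fun b (hb : b < Nat.find h) => Nat.find_min h hb
    set a := Nat.find h
    have ha0 : a ≠ 0 := by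
      intro ha
      rw [ha, pow_zero, div_one] at haσ
      have : 1 * (n : ℝ) < E * n := by gcongr
      linarith
    obtain ⟨k, hk⟩ := Nat.exists_eq_succ_of_ne_zero ha0
    have hk' := hmin k (by omega)
    rw [not_and, not_le] at hk'
    have hxk := hk' (by omega)
    -- By minimality `σ < E · n / 2 ^ (a - 1)`, so `n / 2 ^ a` is within a factor `2E` of `σ`.
    have hxa : n * Q / ((n : ℝ) / 2 ^ a) ≤ 2 * (E * Q * (n / σ)) := by
      rw [div_le_iff₀ (by positivity)]
      have h1 : (n : ℝ) / 2 ^ k = 2 * (n / 2 ^ a) := by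
        rw [hk, Nat.succ_eq_add_one, pow_succ]
        field_simp
      rw [h1] at hxk
      calc n * Q = σ * (Q * n / σ) := by field_simp
        _ ≤ E * (2 * (n / 2 ^ a)) * (Q * n / σ) := by gcongr
        _ = _ := by ring
    have hfirst : (theta1 n ε ℓ a : ℝ) + theta2 n ε ℓ (n / 2 ^ a) ≤
        2 + 4 * (E * Q * (n / σ)) := by
      have h1 := hT1 a
      have h2 := hT2 (n / 2 ^ a) (by positivity)
      linarith
    have hmain := loopCost_le_of_stopsAt M d hε hℓ' hmono k r 0 (fun _ => 0) (by omega) hr1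
    rw [← hn_def, h0, Nat.cast_zero, zero_mul, add_zero, Nat.sub_zero, zero_add, zero_add, zero_add,
      ← Nat.succ_eq_add_one k, ← hk] at hmain
    refine hmain.trans (add_le_add_right ?_ _)
    have hprob := prob_not_stopsAt_le M d hn hε hℓ' ha0 haσ
    rw [← hn_def] at hprob
    calc _ ≤ ENNReal.ofReal (2 + 4 * (E * Q * (n / σ))) * rrCost M d +
          ENNReal.ofReal (2 + 2 * (n * Q)) * rrCost M d * ENNReal.ofReal (1 / n) := by
          gcongr
          · exact ENNReal.natCast_add_natCast_le_ofReal hfirst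
          · exact ENNReal.natCast_add_natCast_le_ofReal hlast
      _ = ENNReal.ofReal (2 + 4 * (E * Q * (n / σ)) + (2 + 2 * (n * Q)) * (1 / n)) *
            rrCost M d := by
          rw [mul_right_comm (ENNReal.ofReal (2 + 2 * (n * Q))), ← ENNReal.ofReal_mul (by positivity),
            ← add_mul, ← ENNReal.ofReal_add (by positivity) (by positivity)]
      _ ≤ _ := by
          refine mul_le_mul_left (ENNReal.ofReal_le_ofReal ?_) _
          have h1 : (2 + 2 * (n * Q)) * (1 / n) = 2 * (1 / n) + 2 * Q := by field_simp
          have h2 : 1 / (n : ℝ) ≤ 1 := by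
            rw [div_le_one hn0]
            exact_mod_cast hn.trans' one_le_two
          rw [h1]
          linarith
  -- Otherwise `σ ≤ 4E`, so the worst-case count `O(1 + nQ)` is already of the desired order.
  · have hσr : σ ≤ E * (n / 2 ^ r) := by
      push Not at h
      exact (h r le_rfl).le
    have hmain := loopCost_le M d hε hℓ' hmono r 0 (fun _ => 0) hr1
    rw [← hn_def, h0, Nat.cast_zero, zero_mul, add_zero, zero_add, zero_add] at hmain
    refine hmain.trans (add_le_add_right ?_ _)
    gcongr
    refine ENNReal.natCast_add_natCast_le_ofReal (hlast.trans ?_)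
    have h1 : n * Q ≤ 4 * (E * Q * (n / σ)) := by
      calc n * Q = σ * (Q * (n / σ)) := by field_simp
        _ ≤ (E * 4) * (Q * (n / σ)) := by
          gcongr
          exact hσr.trans (by gcongr)
        _ = _ := by ring
    linarith

/-- Number of RR sets times cost per set, with `n/σ*` cancelling `σ*/n`. The remaining terms,
including the `O(n log n)` for the tests, are absorbed using `ε ≤ ε₀` and `ℓ ≥ ℓ₀`. -/
theorem expectedTime_rrAlgorithm_le (κ : ℕ) {ε₀ ℓ₀ : ℝ} (hε₀ : 0 < ε₀) (hℓ₀ : 0 < ℓ₀)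
    (M : TriggeringModel V) (d : V → ℕ) (c : Centrality) {ε ℓ : ℝ} (hn : 2 ≤ Fintype.card V)
    (hd : ∀ v, d v ≤ κ * M.inDeg v) (hε : 0 < ε) (hεε₀ : ε ≤ ε₀) (hℓ : ℓ₀ ≤ ℓ) :
    (rrAlgorithm M d c ε ℓ).expectedTime ≤
      ENNReal.ofReal (((10 + 4 * (κ + 4)) * (ε₀ ^ 2 / (ℓ₀ * Real.log 2)) +
          (κ + 4) * (10 * (1 + √2 * ε₀) ^ 2 * ((1 + 3 / ℓ₀) * (2 + ε₀)))) *
        (ℓ * ((M.numEdges : ℝ) + (Fintype.card V : ℝ)) * Real.log (Fintype.card V) / ε ^ 2)) := by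
  have hℓ' : 0 < ℓ := hℓ₀.trans_le hℓ
  have hσ := M.one_le_maxSpread
  have hσn := M.maxSpread_le_card
  have hloop := loopCost_phase1_le M d hn hε hεε₀ hℓ₀ hℓ
  have hcost := rrCost_le M d κ hd
  have hlog2 : 0 < Real.log 2 := Real.log_pos one_lt_two
  have hn2 : (2 : ℝ) ≤ Fintype.card V := by exact_mod_cast hn
  have hlogn : Real.log 2 ≤ Real.log (Fintype.card V) := Real.log_le_log two_pos hn2
  have hr : ((Nat.log 2 (Fintype.card V) - 1 : ℕ) : ℝ) ≤
      Real.log (Fintype.card V) / Real.log 2 :=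
    (Nat.cast_le.2 (Nat.sub_le _ _)).trans (Real.natLog_le_logb _ _)
  rw [expectedTime_rrAlgorithm]
  set n := Fintype.card V with hn_def
  set r := Nat.log 2 n - 1
  set σ := M.maxSpread
  set m := M.numEdges
  set l := Real.log n
  have hl : 0 < l := hlog2.trans_le hlogn
  have hn0 : (0 : ℝ) < n := by positivity
  have hσ0 : 0 < σ := by linarith
  set W := ℓ * l / ε ^ 2 with hW
  have hW0 : 0 < W := by positivity
  have hlW : l / Real.log 2 ≤ ε₀ ^ 2 / (ℓ₀ * Real.log 2) * W := by
    calc l / Real.log 2 = ε ^ 2 / (ℓ * Real.log 2) * W := by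
          rw [hW]
          field_simp
      _ ≤ _ := by gcongr
  have h1l : 1 ≤ l / Real.log 2 := (one_le_div hlog2).2 hlogn
  set E := (1 + √2 * ε) ^ 2 with hE
  have hEle : E ≤ (1 + √2 * ε₀) ^ 2 := by
    rw [hE]
    gcongr
  have hQ : sampleRate n ε ℓ ε₀ ℓ₀ = (1 + 3 / ℓ₀) * (2 + ε₀) * W := rfl
  set P := (1 + 3 / ℓ₀) * (2 + ε₀)
  have hP : 0 < P := by positivity
  rw [hQ] at hloop
  calc _ ≤ ((2 + 3 * n : ℕ) : ENNReal) + (((r * (1 + n) : ℕ) : ENNReal) +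
        ENNReal.ofReal (4 + 10 * E * (P * W) * (n / σ)) *
          ENNReal.ofReal ((κ + 4) * (σ / n) * (m + n))) := by
        gcongr
        exact hloop.trans (by gcongr)
    _ = ENNReal.ofReal (((2 + 3 * n : ℕ) : ℝ) + (((r * (1 + n) : ℕ) : ℝ) +
        (4 + 10 * E * (P * W) * (n / σ)) * ((κ + 4) * (σ / n) * (m + n)))) := by
        rw [← ENNReal.ofReal_natCast (2 + 3 * n), ← ENNReal.ofReal_natCast (r * (1 + n)),
          ← ENNReal.ofReal_mul (by positivity),
          ← ENNReal.ofReal_add (by positivity) (by positivity),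
          ← ENNReal.ofReal_add (by positivity) (by positivity)]
    _ ≤ _ := by
        refine ENNReal.ofReal_le_ofReal ?_
        have ht1 : ((2 + 3 * n : ℕ) : ℝ) ≤ 4 * (m + n) := by
          push_cast
          linarith [(Nat.cast_nonneg m : (0 : ℝ) ≤ m)]
        have ht2 : ((r * (1 + n) : ℕ) : ℝ) ≤ l / Real.log 2 * (2 * (m + n)) := by
          push_cast
          gcongr
          linarith [(Nat.cast_nonneg m : (0 : ℝ) ≤ m)]
        have ht3 : (4 + 10 * E * (P * W) * (n / σ)) * ((κ + 4) * (σ / n) * (m + n)) =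
            4 * (κ + 4) * (m + n) * (σ / n) + (κ + 4) * (10 * E * P) * (W * (m + n)) := by
          field_simp
        have ht4 : σ / n ≤ 1 := (div_le_one hn0).2 hσn
        have hmn : 0 < (m : ℝ) + n := by positivity
        rw [ht3]
        -- `B` dominates both `1` and `log₂ n`, so lower-order terms may be multiplied by it or
        -- bounded by it.
        have hB : 1 ≤ ε₀ ^ 2 / (ℓ₀ * Real.log 2) * W := h1l.trans hlW
        set B := ε₀ ^ 2 / (ℓ₀ * Real.log 2) * W with hBdef
        calc _ ≤ 4 * (m + n) * 1 + (B * (2 * (m + n)) + (4 * (κ + 4) * (m + n) * 1 +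
              (κ + 4) * (10 * (1 + √2 * ε₀) ^ 2 * P) * (W * (m + n)))) := by
              rw [mul_one (4 * ((m : ℝ) + n))]
              gcongr
              exact ht2.trans (by gcongr)
          _ ≤ 8 * (m + n) * B + (B * (2 * (m + n)) + (4 * (κ + 4) * (m + n) * B +
              (κ + 4) * (10 * (1 + √2 * ε₀) ^ 2 * P) * (W * (m + n)))) := by
              gcongr
              norm_num
          _ = _ := by
              rw [hBdef, hW]
              ring

end RunningTime

/-! ### The theorem -/

theorem mainTheorem9 :
    (∀ (V : Type) [Fintype V] [DecidableEq V] [Nonempty V] (M : TriggeringModel V)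
      (drawTime : V → ℕ) (c : Centrality) (ε ℓ : ℝ), 0 < ε → 0 < ℓ →
        ENNReal.ofReal (1 - 1 / (Fintype.card V : ℝ) ^ ℓ) ≤
          (rrAlgorithm M drawTime c ε ℓ).prob
            (fun ψhat => ∀ v, |ψhat v - M.centrality c v| ≤ ε * M.maxSpread)) ∧
    (∀ (κ : ℕ) (ε₀ ℓ₀ : ℝ), 0 < ε₀ → 0 < ℓ₀ → ∃ C : ℝ, 0 < C ∧
      ∀ (V : Type) [Fintype V] [DecidableEq V] [Nonempty V] (M : TriggeringModel V)
        (drawTime : V → ℕ) (c : Centrality) (ε ℓ : ℝ),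
        2 ≤ Fintype.card V → (∀ v, drawTime v ≤ κ * M.inDeg v) →
        0 < ε → ε ≤ ε₀ → ℓ₀ ≤ ℓ →
          (rrAlgorithm M drawTime c ε ℓ).expectedTime ≤
            ENNReal.ofReal (C * (ℓ * ((M.numEdges : ℝ) + (Fintype.card V : ℝ)) *
              Real.log (Fintype.card V) / ε ^ 2))) := by
  refine ⟨fun V _ _ _ M d c ε ℓ hε hℓ => prob_rrAlgorithm_ge M d c hε hℓ,
    fun κ ε₀ ℓ₀ hε₀ hℓ₀ => ⟨_, ?_, fun V _ _ _ M d c ε ℓ hn hd hε hεε₀ hℓ =>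
      expectedTime_rrAlgorithm_le κ hε₀ hℓ₀ M d c hn hd hε hεε₀ hℓ⟩⟩
  have : 0 < Real.log 2 := Real.log_pos one_lt_two
  positivity
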